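/- Let $0<\delta\le 1$ and $q=2+\delta$. For $p\ge 1$ let $X_1,X_2,\dots$ be i.i.d. square-integrable random vectors in $\mathbb R^p$ with mean $0$ and covariance matrix $\Sigma\neq 0$, with eigenvalues $\lambda_1\ge\dots\ge\lambda_p\ge 0$. Put $f_1=\mathrm{tr}\,\Sigma$ and $f=(\mathrm{tr}\,\Sigma^2)^{1/2}=\|\Sigma\|_F$. For $\alpha\in\{0,\delta\}$ set $$K_\alpha=\Big(\mathbb E\Big|\frac{X_1^TX_1-f_1}{f}\Big|^{2+\alpha}\Big)^{1/(2+\alpha)},\qquad D_\alpha=\Big(\mathbb E\Big|\frac{X_1^TX_2}{f}\Big|^{2+\alpha}\Big)^{1/(2+\alpha)},$$ and assume that $K_\delta<\infty$ and $D_\delta<\infty$. With $\xi\sim N(0,1)$ and $\|\xi\|_r=(\mathbb E|\xi|^r)^{1/r}$ put $$c_\alpha=(1+\alpha)^{1/2}\|\xi^2-1\|_{2+\alpha},\quad d_\alpha=(1+\alpha)^{1/2}\|\xi\|_{2+\alpha}^2,\quad \tilde K_\alpha=K_\alpha+c_\alpha,\quad \tilde D_\alpha=D_\alpha+d_\alpha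 .$$ For $n\ge 1$ let $\bar X_n=n^{-1}\sum_{i=1}^nX_i$, $$R_n=\frac{n|\bar X_n|_2^2-f_1}{f},\qquad V=\sum_{j=1}^p\frac{\lambda_j}{f}(\eta_j-1),\quad \eta_j\ \text{i.i.d. } \chi^2_1,$$ and, for $\psi>0$, $$L_\delta(n,\psi)=\psi^2\Big(\frac{\tilde K_0^2}{n}+\frac{\tilde K_0}{n^{1/2}}\Big)+\psi^q\Big[\frac{\tilde K_\delta^q}{n^{q-1}}+\frac{\mathbb E(X_1^T\Sigma X_1)^{q/2}}{n^{\delta/2}f^q}+\frac{\tilde D_\delta^q}{n^\delta}\Big].$$ (a) For every $n\ge1$ the equation $L_\delta(n,\psi)=\psi^{-1/2}$ has a unique solution $\psi=\psi_n>0$, and $$\sup_{t\in\mathbb R}\big|\mathbb P(R_n\le t)-\mathbb P(V\le t)\big|\le C\,\psi_n^{-1/2},$$ where the constant $C$ depends only on $\delta$ (not on $n$, $p$ or the distribution of $X_1$). (b) Let the dimension $p=p_n$ and the distribution of $X_1$ vary with $n$, so that for each $n$ the above assumptions hold, all quantities being computed for the $n$-th distribution. If $$\frac{\tilde K_0^2}{n}+\frac{\tilde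 K_\delta^q}{n^{q-1}}+\frac{\mathbb E(X_1^T\Sigma X_1)^{q/2}}{n^{\delta/2}f^q}+\frac{\tilde D_\delta^q}{n^\delta}\longrightarrow 0\quad\text{as } n\to\infty,$$ then $\psi_n\to\infty$ and $\sup_{t}|\mathbb P(R_n\le t)-\mathbb P(V\le t)|\to 0$. -/

import Mathlib

open MeasureTheory ProbabilityTheory Filter Topology

noncomputable section

namespace HighDimL2

/-- Random vectors take values in `ℝ^p` with the Euclidean norm. -/
abbrev Vec (p : ℕ) : Type := EuclideanSpace ℝ (Fin p)

/-- `(E |Y|^q)^(1/q)`. -/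
def lqNorm {Ω : Type*} [MeasurableSpace Ω] (P : Measure Ω) (q : ℝ) (Y : Ω → ℝ) : ℝ :=
  (∫ ω, |Y ω| ^ q ∂P) ^ (1 / q)

/-- An i.i.d. sequence of square-integrable mean-zero random vectors. -/
structure IsCenteredIID {Ω : Type*} [MeasurableSpace Ω] (P : Measure Ω) {p : ℕ}
    (X : ℕ → Ω → Vec p) : Prop where
  measurable : ∀ i, Measurable (X i)
  indep : iIndepFun X P
  ident : ∀ i, IdentDistrib (X i) (X 0) P P
  memLp : MemLp (X 0) 2 P
  mean : ∫ ω, X 0 ω ∂P = 0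

/-- The covariance matrix of a random vector. -/
def covMat {Ω : Type*} [MeasurableSpace Ω] (P : Measure Ω) {p : ℕ} (Y : Ω → Vec p) :
    Matrix (Fin p) (Fin p) ℝ :=
  Matrix.of fun j k => covariance (fun ω => Y ω j) (fun ω => Y ω k) P

theorem covMat_isHermitian {Ω : Type*} [MeasurableSpace Ω] (P : Measure Ω) {p : ℕ}
    (Y : Ω → Vec p) : (covMat P Y).IsHermitian := by
  ext j k
  simp [covMat, covariance_comm]

/-- The eigenvalues `λ_1, …, λ_p` of the covariance matrix, with multiplicity. -/
def covEig {Ω : Type*} [MeasurableSpace Ω] (P : Measure Ω) {p : ℕ} (Y : Ω → Vec p) :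
    Fin p → ℝ :=
  (covMat_isHermitian P Y).eigenvalues

/-- `f = (tr A²)^(1/2)`, the Frobenius norm of a symmetric matrix `A`. -/
def frob {p : ℕ} (A : Matrix (Fin p) (Fin p) ℝ) : ℝ :=
  Real.sqrt (A ^ 2).trace

section Statistic

variable {Ω : Type*} [MeasurableSpace Ω] (P : Measure Ω) {p : ℕ} (X : ℕ → Ω → Vec p)

/-- `(X₁ᵀX₁ - f₁) / f`; the sequence is indexed from `0`, so `X 0` is the first vector. -/
def normSqStd (ω : Ω) : ℝ :=
  (‖X 0 ω‖ ^ 2 - (covMat P (X 0)).trace) / frob (covMat P (X 0))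

/-- `X₁ᵀX₂ / f`. -/
def crossStd (ω : Ω) : ℝ :=
  inner ℝ (X 0 ω) (X 1 ω) / frob (covMat P (X 0))

/-- `E |(X₁ᵀX₁ - f₁)/f|^(2+δ) < ∞`. -/
def CondK (δ : ℝ) : Prop := Integrable (fun ω => |normSqStd P X ω| ^ (2 + δ)) P

/-- `E |X₁ᵀX₂/f|^(2+δ) < ∞`. -/
def CondD (δ : ℝ) : Prop := Integrable (fun ω => |crossStd P X ω| ^ (2 + δ)) P

/-- `K_δ`. -/
def momK (δ : ℝ) : ℝ := lqNorm P (2 + δ) (normSqStd P X)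

/-- `D_δ`. -/
def momD (δ : ℝ) : ℝ := lqNorm P (2 + δ) (crossStd P X)

/-- `c_δ = (1+δ)^(1/2) ‖ξ² - 1‖_{2+δ}`, `ξ ~ N(0,1)`. -/
def gaussC (δ : ℝ) : ℝ :=
  Real.sqrt (1 + δ) * lqNorm (gaussianReal 0 1) (2 + δ) (fun x => x ^ 2 - 1)

/-- `d_δ = (1+δ)^(1/2) ‖ξ‖²_{2+δ}`, `ξ ~ N(0,1)`. -/
def gaussD (δ : ℝ) : ℝ :=
  Real.sqrt (1 + δ) * lqNorm (gaussianReal 0 1) (2 + δ) (fun x => x) ^ 2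

/-- `K_δ + c_δ`. -/
def tildeK (δ : ℝ) : ℝ := momK P X δ + gaussC δ

/-- `D_δ + d_δ`. -/
def tildeD (δ : ℝ) : ℝ := momD P X δ + gaussD δ

/-- `E (X₁ᵀ Σ X₁)^(q/2)`. -/
def quadMoment (q : ℝ) : ℝ :=
  ∫ ω, ((X 0 ω).ofLp ⬝ᵥ (covMat P (X 0)).mulVec (X 0 ω).ofLp) ^ (q / 2) ∂P

/-- The coefficient of `ψ^q` in `L_δ(n, ψ)`, `q = 2 + δ`. -/
def coeffQ (δ : ℝ) (n : ℕ) : ℝ :=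
  tildeK P X δ ^ (2 + δ) / (n : ℝ) ^ (1 + δ)
    + quadMoment P X (2 + δ) / ((n : ℝ) ^ (δ / 2) * frob (covMat P (X 0)) ^ (2 + δ))
    + tildeD P X δ ^ (2 + δ) / (n : ℝ) ^ δ

/-- `L_δ(n, ψ)`. -/
def Lfun (δ : ℝ) (n : ℕ) (ψ : ℝ) : ℝ :=
  ψ ^ 2 * (tildeK P X 0 ^ 2 / n + tildeK P X 0 / Real.sqrt n)
    + ψ ^ (2 + δ) * coeffQ P X δ n

/-- `ψ` is a (positive) solution of `L_δ(n, ψ) = ψ^(-1/2)`. -/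
def IsPsi (δ : ℝ) (n : ℕ) (ψ : ℝ) : Prop :=
  0 < ψ ∧ Lfun P X δ n ψ = ψ ^ (-(1 / 2) : ℝ)

/-- The sample mean of the first `n` vectors. -/
def sampleMean (n : ℕ) (ω : Ω) : Vec p := (n : ℝ)⁻¹ • ∑ i ∈ Finset.range n, X i ω

/-- `R_n = (n |X̄_n|² - f₁) / f`. -/
def Rstat (n : ℕ) (ω : Ω) : ℝ :=
  (n * ‖sampleMean X n ω‖ ^ 2 - (covMat P (X 0)).trace) / frob (covMat P (X 0))

/-- The `χ²₁` distribution: the law of `ξ²`, `ξ ~ N(0,1)`. -/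
def chiSqOne : Measure ℝ := (gaussianReal 0 1).map (fun x => x ^ 2)

/-- `V = ∑ⱼ (λⱼ/f)(ηⱼ - 1)` as a function of `η = (η₁, …, η_p)`. -/
def Vstat (η : Fin p → ℝ) : ℝ :=
  ∑ j, covEig P (X 0) j / frob (covMat P (X 0)) * (η j - 1)

/-- `sup_t |P(R_n ≤ t) - P(V ≤ t)|`, where the `ηⱼ` in `V` are i.i.d. `χ²₁`. -/
def kolmDist (n : ℕ) : ℝ :=
  ⨆ t : ℝ, |P.real {ω | Rstat P X n ω ≤ t}
    - (Measure.pi fun _ : Fin p => chiSqOne).real {η | Vstat P X η ≤ t}|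

/-- The quantity whose convergence to `0` forces `ψ_n → ∞`. -/
def smallQty (δ : ℝ) (n : ℕ) : ℝ := tildeK P X 0 ^ 2 / n + coeffQ P X δ n

end Statistic

end HighDimL2

end

open HighDimL2

/-! ### Elementary inequalities -/

/-! The proof is Lindeberg's replacement method, followed by smoothing. Write `Q h = hᵀΣh`, and let
`μ` be the law of `X₁` and `γ` the centred Gaussian law with covariance `Σ`. Since a sum of `n`
copies of `γ` is `√n` times one copy, the statistic `R_n` of a Gaussian sample has exactly the law
of `V`. It therefore suffices to exchange the summands one at a time.

With `h` the sum of the other summands, `‖h + x‖² = ‖h‖² + f₁ + (2 h·x + (‖x‖² - f₁))`. A smooth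
cutoff `g` of slope `θ = ψ/(n f)` is expanded to second order around `‖h‖² + f₁`. The linear term
has mean zero and `(h·x)²` has mean `Q h`, so these contributions agree for `μ` and `γ`
(`abs_integral_conv_sub_le`). What remains is the product `h·x (‖x‖² - f₁)`, the square `(‖x‖² -
f₁)²` and a Taylor remainder of order `q = 2 + δ`. A Rosenthal inequality for exponents in `(2, 3]`
bounds the `q`-th moment of `h·x`, given `x`, by multiples of `n^(q/2) Q(x)^(q/2)` and `n E|x·X|^q`,
plus the Gaussian analogue of the latter. Multiplied by the `n` exchanges, these errors are a
constant times `L_δ(n, ψ)` (`abs_integral_convPow_sub_le`, `replacement_error_le`).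

Passing from `g` to indicators costs the mass that `V` gives to an interval of length `2/ψ`. The
characteristic function of `V` is at most `|s|^(-1/2)` because the coefficients `λ_j/f` have unit
square sum, so this mass is `O(ψ^(-1/2))` whatever the spectrum (`measureReal_quadratic_Icc_le`).
Hence the Kolmogorov distance is at most `C (L_δ(n, ψ) + ψ^(-1/2))` for every `ψ > 0`, and `ψ_n`
balances the two terms. When the coefficients of `L_δ` vanish in the limit, the balance point
escapes to infinity, which is (b). -/

theorem abs_rpow_sub_abs_rpow_mul_le {s : ℝ} (hs0 : 0 < s) (hs1 : s ≤ 1) (u v : ℝ) :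
    |(|u| ^ s - |v| ^ s)| * |v| ≤ |v| ^ s * |u - v| := by
  -- For positive arguments this says that `x ^ (s - 1)` is nonincreasing.
  have key : ∀ x y : ℝ, 0 ≤ y → y ≤ x → x ^ s * y ≤ y ^ s * x := by
    intro x y hy hxy
    rcases hy.eq_or_lt with rfl | hy
    · simp [Real.zero_rpow hs0.ne']
    have hx : 0 < x := hy.trans_le hxy
    have e1 : y = y ^ s * y ^ (1 - s) := by
      rw [← Real.rpow_add hy]; simp
    have e2 : x = x ^ s * x ^ (1 - s) := by
      rw [← Real.rpow_add hx]; simp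
    calc x ^ s * y = x ^ s * (y ^ s * y ^ (1 - s)) := by rw [← e1]
      _ ≤ x ^ s * (y ^ s * x ^ (1 - s)) := by
          gcongr
      _ = y ^ s * (x ^ s * x ^ (1 - s)) := by ring
      _ = y ^ s * x := by rw [← e2]
  have hv := Real.rpow_nonneg (abs_nonneg v) s
  rcases le_total |v| |u| with h | h
  · have h1 := Real.rpow_le_rpow (abs_nonneg v) h hs0.le
    rw [abs_of_nonneg (by linarith)]
    have := key |u| |v| (abs_nonneg v) h
    have h2 : |u| - |v| ≤ |u - v| := abs_sub_abs_le_abs_sub u v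
    nlinarith
  · have h1 := Real.rpow_le_rpow (abs_nonneg u) h hs0.le
    rw [abs_of_nonpos (by linarith)]
    have := key |v| |u| (abs_nonneg u) h
    have h2 : |v| - |u| ≤ |u - v| := by rw [abs_sub_comm]; exact abs_sub_abs_le_abs_sub v u
    nlinarith

/-- Up to a factor, `|x| ^ s * x` is the derivative of `|x| ^ (2 + s)`; its increments control the
Taylor remainder below. -/
theorem abs_rpow_mul_self_sub_le {s : ℝ} (hs0 : 0 < s) (hs1 : s ≤ 1) (u v : ℝ) :
    |(|u| ^ s * u - |v| ^ s * v)| ≤ (|u| ^ s + |v| ^ s) * |u - v| := by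
  have h := abs_rpow_sub_abs_rpow_mul_le hs0 hs1 u v
  calc |(|u| ^ s * u - |v| ^ s * v)| = |(|u| ^ s * (u - v) + (|u| ^ s - |v| ^ s) * v)| := by
        congr 1; ring
    _ ≤ |u| ^ s * |u - v| + |(|u| ^ s - |v| ^ s)| * |v| := by
        refine (abs_add_le _ _).trans (le_of_eq ?_)
        rw [abs_mul, abs_mul, abs_of_nonneg (Real.rpow_nonneg (abs_nonneg u) s)]
    _ ≤ _ := by linarith

theorem abs_add_rpow_le {a b s : ℝ} (hs0 : 0 < s) (hs1 : s ≤ 1) :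
    |a + b| ^ s ≤ |a| ^ s + |b| ^ s :=
  (Real.rpow_le_rpow (abs_nonneg _) (abs_add_le a b) hs0.le).trans
    (Real.rpow_add_le_add_rpow (abs_nonneg _) (abs_nonneg _) hs0.le hs1)

theorem abs_rpow_mul_sq {x s : ℝ} (hs : 0 < s) : |x| ^ s * x ^ 2 = |x| ^ (2 + s) := by
  rw [add_comm, Real.rpow_add_of_nonneg (abs_nonneg x) hs.le (by norm_num)]
  simp

/-- Mean value theorem along the segment from `a` to `a + b`. The linear term is kept exactly,
because it integrates to zero when `b` is centred and independent of `a`. The constant 6 is the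
factor `2 + δ ≤ 3` times the 2 of `h6`. -/
theorem abs_add_rpow_le_taylor {δ : ℝ} (hδ0 : 0 < δ) (hδ1 : δ ≤ 1) (a b : ℝ) :
    |a + b| ^ (2 + δ) ≤ |a| ^ (2 + δ) + (2 + δ) * (|a| ^ δ * a) * b
      + 6 * (|a| ^ δ * b ^ 2 + |b| ^ (2 + δ)) := by
  have hder : ∀ x : ℝ, HasDerivAt (fun t => |a + t * b| ^ (2 + δ))
      ((2 + δ) * |a + x * b| ^ δ * (a + x * b) * b) x := by
    intro x
    have h1 := hasDerivAt_abs_rpow (a + x * b) (p := 2 + δ) (by linarith)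
    have h2 : HasDerivAt (fun t : ℝ => a + t * b) b x := by
      simpa using ((hasDerivAt_id x).mul_const b).const_add a
    exact (h1.comp x h2).congr_deriv (by rw [add_sub_cancel_left])
  obtain ⟨c, hc, h⟩ := exists_hasDerivAt_eq_slope _ _ (zero_lt_one)
    (fun x _ => (hder x).continuousAt.continuousWithinAt) (fun x _ => hder x)
  simp only [one_mul, zero_mul, add_zero, sub_zero, div_one] at h
  have h3 := abs_rpow_mul_self_sub_le hδ0 hδ1 (a + c * b) a
  have hcb : |c * b| ≤ |b| := by
    rw [abs_mul, abs_of_pos hc.1]; nlinarith [abs_nonneg b, hc.2]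
  have h4 : |a + c * b| ^ δ ≤ |a| ^ δ + |b| ^ δ :=
    (abs_add_rpow_le hδ0 hδ1).trans (by gcongr)
  have ha := Real.rpow_nonneg (abs_nonneg a) δ
  have hb := Real.rpow_nonneg (abs_nonneg b) δ
  have e : a + c * b - a = c * b := by ring
  rw [e] at h3
  have h5 : |(|a + c * b| ^ δ * (a + c * b) - |a| ^ δ * a)| ≤ (2 * |a| ^ δ + |b| ^ δ) * |b| := by
    exact h3.trans (mul_le_mul (by linarith) hcb (abs_nonneg _) (by positivity))
  have h6 : (|a + c * b| ^ δ * (a + c * b) - |a| ^ δ * a) * b ≤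
      2 * (|a| ^ δ * b ^ 2) + |b| ^ (2 + δ) := by
    refine (le_abs_self _).trans ?_
    rw [abs_mul, ← abs_rpow_mul_sq hδ0, ← sq_abs b]
    nlinarith [mul_le_mul_of_nonneg_right h5 (abs_nonneg b)]
  have h7 : |a + b| ^ (2 + δ) - |a| ^ (2 + δ) - (2 + δ) * (|a| ^ δ * a) * b =
      (2 + δ) * ((|a + c * b| ^ δ * (a + c * b) - |a| ^ δ * a) * b) := by
    rw [← h]; ring
  have h8 : 0 ≤ |a| ^ δ * b ^ 2 := by positivity
  have h9 : 0 ≤ |b| ^ (2 + δ) := by positivity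
  nlinarith

theorem abs_add_rpow_le_mul {q : ℝ} (hq : 0 ≤ q) (a b : ℝ) :
    |a + b| ^ q ≤ 2 ^ q * (|a| ^ q + |b| ^ q) := by
  have ha := Real.rpow_nonneg (abs_nonneg a) q
  have hb := Real.rpow_nonneg (abs_nonneg b) q
  have h2 : (0 : ℝ) ≤ 2 ^ q := by positivity
  rcases le_total |a| |b| with h | h
  · calc |a + b| ^ q ≤ (2 * |b|) ^ q :=
          Real.rpow_le_rpow (abs_nonneg _) ((abs_add_le a b).trans (by linarith)) hq
      _ = 2 ^ q * |b| ^ q := Real.mul_rpow (by norm_num) (abs_nonneg _)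
      _ ≤ _ := by nlinarith
  · calc |a + b| ^ q ≤ (2 * |a|) ^ q :=
          Real.rpow_le_rpow (abs_nonneg _) ((abs_add_le a b).trans (by linarith)) hq
      _ = 2 ^ q * |a| ^ q := Real.mul_rpow (by norm_num) (abs_nonneg _)
      _ ≤ _ := by nlinarith

/-! ### A smooth cutoff and its Taylor expansion -/

/-- `M` bounds the error of the second order Taylor expansion of `g`, with the derivatives
`g₁` and `g₂`. -/
structure IsTaylorCutoff (g g₁ g₂ : ℝ → ℝ) (M : ℝ) : Prop where
  cont : Continuous g
  cont₁ : Continuous g₁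
  cont₂ : Continuous g₂
  nonneg : ∀ x, 0 ≤ g x
  le_one : ∀ x, g x ≤ 1
  eq_one : ∀ x ≤ 0, g x = 1
  eq_zero : ∀ x, 1 ≤ x → g x = 0
  bound₁ : ∀ x, |g₁ x| ≤ M
  bound₂ : ∀ x, |g₂ x| ≤ M
  taylor : ∀ δ : ℝ, 0 < δ → δ ≤ 1 → ∀ w d,
    |g (w + d) - (g w + g₁ w * d + 1 / 2 * (g₂ w * d ^ 2))| ≤ M * |d| ^ (2 + δ)

/-- The mean value inequality is applied twice: an oscillation `K` of `g₂` gives an error `K |d|`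
for `g₁`, then `K d²` for `g`. -/
theorem taylor_two_bound {g g₁ g₂ : ℝ → ℝ} {w d K : ℝ}
    (h1 : ∀ x, HasDerivAt g (g₁ x) x) (h2 : ∀ x, HasDerivAt g₁ (g₂ x) x)
    (hK : ∀ t, |t| ≤ |d| → |g₂ (w + t) - g₂ w| ≤ K) :
    |g (w + d) - (g w + g₁ w * d + 1 / 2 * (g₂ w * d ^ 2))| ≤ K * d ^ 2 := by
  have mem : ∀ t, t ∈ Set.Icc (-|d|) |d| ↔ |t| ≤ |d| := fun t => by
    rw [Set.mem_Icc, abs_le]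
  have z : (0 : ℝ) ∈ Set.Icc (-|d|) |d| := by rw [mem]; simp
  have hK0 : 0 ≤ K := (abs_nonneg _).trans (hK 0 (by simp))
  have hs : ∀ x : ℝ, HasDerivAt (fun t => w + t) 1 x := fun x => (hasDerivAt_id x).const_add w
  have A : ∀ t, |t| ≤ |d| → |g₁ (w + t) - g₁ w - g₂ w * t| ≤ K * |d| := by
    intro t ht
    have := (convex_Icc (-|d|) |d|).norm_image_sub_le_of_norm_hasDerivWithin_le
      (f := fun t => g₁ (w + t) - g₁ w - g₂ w * t) (f' := fun t => g₂ (w + t) - g₂ w) (C := K)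
      (fun x _ => by
        have := (((h2 (w + x)).comp x (hs x)).sub_const (g₁ w)).sub
          ((hasDerivAt_id x).const_mul (g₂ w))
        exact (this.congr_deriv (by simp)).hasDerivWithinAt)
      (fun x hx => hK x ((mem x).1 hx)) z ((mem t).2 ht)
    simp only [add_zero, mul_zero, sub_self, sub_zero, Real.norm_eq_abs] at this
    exact this.trans (by gcongr)
  have := (convex_Icc (-|d|) |d|).norm_image_sub_le_of_norm_hasDerivWithin_le
      (f := fun t => g (w + t) - (g w + g₁ w * t + 1 / 2 * (g₂ w * t ^ 2)))
      (f' := fun t => g₁ (w + t) - g₁ w - g₂ w * t) (C := K * |d|)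
      (fun x _ => by
        have := ((h1 (w + x)).comp x (hs x)).sub
          ((((hasDerivAt_id x).const_mul (g₁ w)).const_add (g w)).add
          (((hasDerivAt_pow 2 x).const_mul (g₂ w)).const_mul (1 / 2)))
        exact (this.congr_deriv (by simp; ring)).hasDerivWithinAt)
      (fun x hx => A x ((mem x).1 hx)) z ((mem d).2 le_rfl)
  simp only [add_zero, mul_zero, sub_self, sub_zero, Real.norm_eq_abs, ne_eq, OfNat.ofNat_ne_zero,
    not_false_eq_true, zero_pow] at this
  refine this.trans (le_of_eq ?_)
  rw [← sq_abs d]; ring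

/-- A smooth step is constant outside `[0, 1]`, so its derivatives have compact support and are
bounded. The increment of `g₂` is at most both `M3 |d|` and `2 M2`; the first bound serves for `|d|
≤ 1`, the second otherwise, and either is at most a multiple of `|d| ^ δ`. Thus one `M` works for
all `δ` in `(0, 1]`. -/
theorem exists_isTaylorCutoff : ∃ (g g₁ g₂ : ℝ → ℝ) (M : ℝ), 0 < M ∧ IsTaylorCutoff g g₁ g₂ M := by
  set g : ℝ → ℝ := fun x => Real.smoothTransition (1 - x) with hg
  have hsm : ContDiff ℝ 3 g := (Real.smoothTransition.contDiff).comp (contDiff_const.sub contDiff_id)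
  have one : ∀ x ≤ 0, g x = 1 := fun x hx => Real.smoothTransition.one_of_one_le (by linarith)
  have zero : ∀ x, 1 ≤ x → g x = 0 := fun x hx =>
    Real.smoothTransition.zero_of_nonpos (by linarith)
  have hs1 : ContDiff ℝ 2 (deriv g) := (contDiff_succ_iff_deriv (n := 2)).1 hsm |>.2.2
  have hs2 : ContDiff ℝ 1 (deriv (deriv g)) := (contDiff_succ_iff_deriv (n := 1)).1 hs1 |>.2.2
  have hs3 : ContDiff ℝ 0 (deriv (deriv (deriv g))) :=
    (contDiff_succ_iff_deriv (n := 0)).1 hs2 |>.2.2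
  have c1 : HasCompactSupport (deriv g) := by
    refine HasCompactSupport.intro (isCompact_Icc (a := (0 : ℝ)) (b := 1)) fun x hx => ?_
    rw [Set.mem_Icc, not_and_or, not_le, not_le] at hx
    rcases hx with hx | hx
    · have : g =ᶠ[𝓝 x] fun _ => 1 := by
        filter_upwards [Iio_mem_nhds hx] with y hy using one y (le_of_lt hy)
      rw [this.deriv_eq]; simp
    · have : g =ᶠ[𝓝 x] fun _ => 0 := by
        filter_upwards [Ioi_mem_nhds hx] with y hy using zero y (le_of_lt hy)
      rw [this.deriv_eq]; simp
  obtain ⟨M1, hM1⟩ := c1.exists_bound_of_continuous hs1.continuous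
  obtain ⟨M2, hM2⟩ := c1.deriv.exists_bound_of_continuous hs2.continuous
  obtain ⟨M3, hM3⟩ := c1.deriv.deriv.exists_bound_of_continuous hs3.continuous
  have d1 : ∀ x, HasDerivAt g (deriv g x) x := fun x =>
    (hsm.differentiable (by norm_num) x).hasDerivAt
  have d2 : ∀ x, HasDerivAt (deriv g) (deriv (deriv g) x) x := fun x =>
    (hs1.differentiable (by norm_num) x).hasDerivAt
  have hM1' := (norm_nonneg _).trans (hM1 0)
  have hM2' := (norm_nonneg _).trans (hM2 0)
  have hM3' := (norm_nonneg _).trans (hM3 0)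
  refine ⟨g, deriv g, deriv (deriv g), M1 + 2 * M2 + M3 + 1, by positivity, ?_⟩
  refine ⟨hsm.continuous, hs1.continuous, hs2.continuous, fun x => Real.smoothTransition.nonneg _,
    fun x => Real.smoothTransition.le_one _, one, zero,
    fun x => (hM1 x).trans (by linarith), fun x => (hM2 x).trans (by linarith), ?_⟩
  intro δ hδ0 hδ1 w d
  rw [← abs_rpow_mul_sq hδ0, ← mul_assoc _ (|d| ^ δ)]
  refine taylor_two_bound d1 d2 fun t ht => ?_
  have hd := Real.rpow_nonneg (abs_nonneg d) δ
  rcases le_total |d| 1 with h | h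
  · have L := (convex_univ (𝕜 := ℝ)).norm_image_sub_le_of_norm_deriv_le (C := M3)
      (f := deriv (deriv g))
      (fun x _ => hs2.differentiable (by norm_num) x) (fun x _ => hM3 x)
      (Set.mem_univ w) (Set.mem_univ (w + t))
    simp only [Real.norm_eq_abs, add_sub_cancel_left] at L
    have : |d| ≤ |d| ^ δ := by
      simpa using Real.rpow_le_rpow_of_exponent_ge_of_imp (abs_nonneg d) h hδ1
        (fun _ h0 => absurd h0 one_ne_zero)
    calc _ ≤ M3 * |t| := L
      _ ≤ M3 * |d| ^ δ := by gcongr; exact ht.trans this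
      _ ≤ _ := by gcongr; linarith
  · have : 1 ≤ |d| ^ δ := Real.one_le_rpow h hδ0.le
    have := (abs_sub (deriv (deriv g) (w + t)) (deriv (deriv g) w)).trans
      (add_le_add (hM2 (w + t)) (hM2 w))
    nlinarith

/-! ### Moments of sums of independent random variables -/

theorem rpow_le_one_add_rpow {x r q : ℝ} (hx : 0 ≤ x) (hr : 0 ≤ r) (hrq : r ≤ q) :
    x ^ r ≤ 1 + x ^ q := by
  rcases le_total x 1 with h | h
  · have := Real.rpow_le_one hx h hr
    have := Real.rpow_nonneg hx q
    linarith
  · have := Real.rpow_le_rpow_of_exponent_le h hrq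
    linarith

section Moments

variable {Ω : Type*} [MeasurableSpace Ω] {P : Measure Ω}

theorem integrable_abs_add_rpow {U Z : Ω → ℝ} {q : ℝ} (hq : 0 ≤ q)
    (hU : Measurable U) (hZ : Measurable Z) (hUi : Integrable (fun ω => |U ω| ^ q) P)
    (hZi : Integrable (fun ω => |Z ω| ^ q) P) :
    Integrable (fun ω => |U ω + Z ω| ^ q) P :=
  ((hUi.add hZi).const_mul (2 ^ q)).mono' (by fun_prop) (ae_of_all _ fun ω => by
    rw [Real.norm_of_nonneg (by positivity)]
    exact abs_add_rpow_le_mul hq _ _)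

theorem integral_add_sq_of_indepFun {U Z : Ω → ℝ} (hUZ : IndepFun U Z P)
    (hU : Integrable U P) (hZ : Integrable Z P) (hU2 : Integrable (fun ω => U ω ^ 2) P)
    (hZ2 : Integrable (fun ω => Z ω ^ 2) P) (hZ0 : ∫ ω, Z ω ∂P = 0) :
    ∫ ω, (U ω + Z ω) ^ 2 ∂P = ∫ ω, U ω ^ 2 ∂P + ∫ ω, Z ω ^ 2 ∂P := by
  have e : ∫ ω, U ω * Z ω ∂P = 0 := by
    rw [hUZ.integral_fun_mul_eq_mul_integral hU.1 hZ.1, hZ0, mul_zero]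
  have i : Integrable (fun ω => U ω * Z ω) P := hUZ.integrable_mul hU hZ
  calc ∫ ω, (U ω + Z ω) ^ 2 ∂P = ∫ ω, (U ω ^ 2 + 2 * (U ω * Z ω) + Z ω ^ 2) ∂P := by
        congr with ω; ring
    _ = _ := by
        have k : Integrable (fun ω => U ω ^ 2 + 2 * (U ω * Z ω)) P := hU2.add (i.const_mul 2)
        rw [integral_add k hZ2, integral_add hU2 (i.const_mul 2),
          integral_const_mul, e, mul_zero, add_zero]

variable [IsProbabilityMeasure P]

theorem integrable_of_abs_le_one_add_rpow {U F : Ω → ℝ} {q : ℝ} (c : ℝ)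
    (hUi : Integrable (fun ω => |U ω| ^ q) P) (hF : Measurable F)
    (h : ∀ ω, |F ω| ≤ c * (1 + |U ω| ^ q)) : Integrable F P :=
  (((integrable_const 1).add hUi).const_mul c).mono' hF.aestronglyMeasurable
    (ae_of_all _ fun ω => h ω)

theorem integrable_abs_rpow_of_le {U : Ω → ℝ} {r q : ℝ} (hr : 0 ≤ r) (hrq : r ≤ q)
    (hU : Measurable U) (hUi : Integrable (fun ω => |U ω| ^ q) P) :
    Integrable (fun ω => |U ω| ^ r) P :=
  integrable_of_abs_le_one_add_rpow 1 hUi (by fun_prop) fun ω => by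
    rw [one_mul, abs_of_nonneg (by positivity)]
    exact rpow_le_one_add_rpow (abs_nonneg _) hr hrq

theorem integrable_of_abs_rpow {U : Ω → ℝ} {q : ℝ} (hq : 1 ≤ q)
    (hU : Measurable U) (hUi : Integrable (fun ω => |U ω| ^ q) P) : Integrable U P :=
  integrable_of_abs_le_one_add_rpow 1 hUi hU fun ω => by
    have := rpow_le_one_add_rpow (abs_nonneg (U ω)) zero_le_one hq
    simpa using this

theorem integrable_sq_of_abs_rpow {U : Ω → ℝ} {q : ℝ} (hq : 2 ≤ q)
    (hU : Measurable U) (hUi : Integrable (fun ω => |U ω| ^ q) P) :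
    Integrable (fun ω => U ω ^ 2) P := by
  simpa using integrable_abs_rpow_of_le zero_le_two hq hU hUi

theorem integral_rpow_le_rpow_integral {f : Ω → ℝ} {r : ℝ} (hr0 : 0 ≤ r) (hr1 : r ≤ 1)
    (hf : ∀ ω, 0 ≤ f ω) (hfi : Integrable f P) (hri : Integrable (fun ω => f ω ^ r) P) :
    ∫ ω, f ω ^ r ∂P ≤ (∫ ω, f ω ∂P) ^ r :=
  (Real.concaveOn_rpow hr0 hr1).le_map_integral
    (Real.continuous_rpow_const hr0).continuousOn isClosed_Ici
    (ae_of_all _ fun ω => hf ω) hfi hri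

theorem rpow_integral_le_integral_rpow {f : Ω → ℝ} {r : ℝ} (hr : 1 ≤ r)
    (hf : ∀ ω, 0 ≤ f ω) (hfi : Integrable f P) (hri : Integrable (fun ω => f ω ^ r) P) :
    (∫ ω, f ω ∂P) ^ r ≤ ∫ ω, f ω ^ r ∂P :=
  (convexOn_rpow hr).map_integral_le
    (Real.continuous_rpow_const (by linarith)).continuousOn isClosed_Ici
    (ae_of_all _ fun ω => hf ω) hfi hri

theorem integral_abs_rpow_le_sq {U : Ω → ℝ} {δ : ℝ} (hδ0 : 0 < δ) (hδ1 : δ ≤ 1)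
    (hU : Measurable U) (hUi : Integrable (fun ω => |U ω| ^ (2 + δ)) P) :
    ∫ ω, |U ω| ^ δ ∂P ≤ (∫ ω, U ω ^ 2 ∂P) ^ (δ / 2) := by
  have e : ∀ x : ℝ, |x| ^ δ = (x ^ 2) ^ (δ / 2) := fun x => by
    rw [← sq_abs, ← Real.rpow_natCast, ← Real.rpow_mul (abs_nonneg _)]
    congr 1
    push_cast; ring
  have h1 := integrable_abs_rpow_of_le hδ0.le (by linarith) hU hUi
  simp_rw [e] at h1 ⊢
  exact integral_rpow_le_rpow_integral (by linarith) (by linarith) (fun ω => sq_nonneg _)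
    (integrable_sq_of_abs_rpow (by linarith) hU hUi) h1

/-- One induction step of Rosenthal's inequality. Integrating `abs_add_rpow_le_taylor`, independence
removes the linear term and factorises `|U| ^ δ * Z ^ 2`; Jensen's inequality then bounds `E|U| ^ δ`
by a power of the variance. -/
theorem integral_abs_add_rpow_le {U Z : Ω → ℝ} {δ : ℝ} (hδ0 : 0 < δ) (hδ1 : δ ≤ 1)
    (hUZ : IndepFun U Z P) (hU : Measurable U) (hZ : Measurable Z)
    (hUi : Integrable (fun ω => |U ω| ^ (2 + δ)) P)
    (hZi : Integrable (fun ω => |Z ω| ^ (2 + δ)) P) (hZ0 : ∫ ω, Z ω ∂P = 0) :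
    ∫ ω, |U ω + Z ω| ^ (2 + δ) ∂P ≤ ∫ ω, |U ω| ^ (2 + δ) ∂P
      + 6 * ((∫ ω, U ω ^ 2 ∂P) ^ (δ / 2) * ∫ ω, Z ω ^ 2 ∂P + ∫ ω, |Z ω| ^ (2 + δ) ∂P) := by
  have iZ : Integrable Z P := integrable_of_abs_rpow (by linarith) hZ hZi
  have iZ2 : Integrable (fun ω => Z ω ^ 2) P := integrable_sq_of_abs_rpow (by linarith) hZ hZi
  have iU : Integrable (fun ω => |U ω| ^ δ) P :=
    integrable_abs_rpow_of_le hδ0.le (by linarith) hU hUi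
  have iU' : Integrable (fun ω => |U ω| ^ δ * U ω) P :=
    integrable_of_abs_le_one_add_rpow 1 hUi (by fun_prop) fun ω => by
      have : |(|U ω| ^ δ * U ω)| = |U ω| ^ (δ + 1) := by
        rw [abs_mul, abs_of_nonneg (by positivity), Real.rpow_add_of_nonneg (abs_nonneg _) hδ0.le
          zero_le_one, Real.rpow_one]
      rw [this, one_mul]
      exact rpow_le_one_add_rpow (abs_nonneg _) (by linarith) (by linarith)
  have i1 : IndepFun (fun ω => |U ω| ^ δ * U ω) Z P :=
    hUZ.comp (φ := fun u => |u| ^ δ * u) (ψ := id) (by fun_prop) measurable_id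
  have i2 : IndepFun (fun ω => |U ω| ^ δ) (fun ω => Z ω ^ 2) P :=
    hUZ.comp (φ := fun u => |u| ^ δ) (ψ := fun z => z ^ 2) (by fun_prop) (by fun_prop)
  have e1 : ∫ ω, |U ω| ^ δ * U ω * Z ω ∂P = 0 := by
    rw [i1.integral_fun_mul_eq_mul_integral iU'.1 iZ.1, hZ0, mul_zero]
  have e2 : ∫ ω, |U ω| ^ δ * Z ω ^ 2 ∂P = (∫ ω, |U ω| ^ δ ∂P) * ∫ ω, Z ω ^ 2 ∂P :=
    i2.integral_fun_mul_eq_mul_integral iU.1 iZ2.1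
  have j1 : Integrable (fun ω => |U ω| ^ δ * U ω * Z ω) P := i1.integrable_mul iU' iZ
  have j2 : Integrable (fun ω => |U ω| ^ δ * Z ω ^ 2) P := i2.integrable_mul iU iZ2
  calc ∫ ω, |U ω + Z ω| ^ (2 + δ) ∂P
      ≤ ∫ ω, (|U ω| ^ (2 + δ) + (2 + δ) * (|U ω| ^ δ * U ω * Z ω)
        + 6 * (|U ω| ^ δ * Z ω ^ 2 + |Z ω| ^ (2 + δ))) ∂P := by
        refine integral_mono (integrable_abs_add_rpow (by linarith) hU hZ hUi hZi)
          ((hUi.add (j1.const_mul _)).add ((j2.add hZi).const_mul 6)) fun ω => ?_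
        have := abs_add_rpow_le_taylor hδ0 hδ1 (U ω) (Z ω)
        rwa [mul_assoc (2 + δ)] at this
    _ = ∫ ω, |U ω| ^ (2 + δ) ∂P + 6 * ((∫ ω, |U ω| ^ δ ∂P) * ∫ ω, Z ω ^ 2 ∂P
        + ∫ ω, |Z ω| ^ (2 + δ) ∂P) := by
        have k1 : Integrable (fun ω => |U ω| ^ (2 + δ) + (2 + δ) * (|U ω| ^ δ * U ω * Z ω)) P :=
          hUi.add (j1.const_mul _)
        have k2 : Integrable (fun ω => 6 * (|U ω| ^ δ * Z ω ^ 2 + |Z ω| ^ (2 + δ))) P :=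
          (j2.add hZi).const_mul 6
        rw [integral_add k1 k2,
          integral_add hUi (j1.const_mul _), integral_const_mul, e1, integral_const_mul,
          integral_add j2 hZi, e2, mul_zero, add_zero]
    _ ≤ _ := by
        have h2 : 0 ≤ ∫ ω, Z ω ^ 2 ∂P := integral_nonneg fun ω => sq_nonneg (Z ω)
        gcongr
        exact integral_abs_rpow_le_sq hδ0 hδ1 hU hUi

/-- Rosenthal's inequality for the exponents between `2` and `3`. -/
theorem integral_abs_sum_rpow_le {ι : Type*} {Z : ι → Ω → ℝ} {δ : ℝ} (hδ0 : 0 < δ) (hδ1 : δ ≤ 1)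
    (hind : iIndepFun Z P) (hZ : ∀ i, Measurable (Z i))
    (hZi : ∀ i, Integrable (fun ω => |Z i ω| ^ (2 + δ)) P) (hZ0 : ∀ i, ∫ ω, Z i ω ∂P = 0)
    {B : ℝ} (s : Finset ι) (hB : ∑ i ∈ s, ∫ ω, Z i ω ^ 2 ∂P ≤ B) :
    Integrable (fun ω => |∑ i ∈ s, Z i ω| ^ (2 + δ)) P ∧
    ∫ ω, (∑ i ∈ s, Z i ω) ^ 2 ∂P = ∑ i ∈ s, ∫ ω, Z i ω ^ 2 ∂P ∧
    ∫ ω, |∑ i ∈ s, Z i ω| ^ (2 + δ) ∂P ≤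
      6 * (B ^ (δ / 2) * ∑ i ∈ s, ∫ ω, Z i ω ^ 2 ∂P + ∑ i ∈ s, ∫ ω, |Z i ω| ^ (2 + δ) ∂P) := by
  classical
  induction s using Finset.induction_on with
  | empty => simp [Real.zero_rpow (show 2 + δ ≠ 0 by positivity)]
  | insert a s ha ih =>
    rw [Finset.sum_insert ha] at hB
    have h2 : ∀ i, 0 ≤ ∫ ω, Z i ω ^ 2 ∂P := fun i => integral_nonneg fun ω => sq_nonneg _
    obtain ⟨ih1, ih2, ih3⟩ := ih (by linarith [h2 a])
    have hm : Measurable (fun ω => ∑ i ∈ s, Z i ω) := by fun_prop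
    have hi : IndepFun (fun ω => ∑ i ∈ s, Z i ω) (Z a) P := by
      have := hind.indepFun_finsetSum_of_notMem hZ ha
      rwa [Finset.sum_fn] at this
    have iZ := integrable_of_abs_rpow (by linarith) (hZ a) (hZi a)
    have iZ2 := integrable_sq_of_abs_rpow (by linarith) (hZ a) (hZi a)
    have iS := integrable_of_abs_rpow (by linarith) hm ih1
    have iS2 := integrable_sq_of_abs_rpow (by linarith) hm ih1
    have key := integral_abs_add_rpow_le hδ0 hδ1 hi hm (hZ a) ih1 (hZi a) (hZ0 a)
    have e : ∀ ω, ∑ i ∈ insert a s, Z i ω = (∑ i ∈ s, Z i ω) + Z a ω := fun ω => by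
      rw [Finset.sum_insert ha, add_comm]
    simp_rw [e]
    refine ⟨integrable_abs_add_rpow (by linarith) hm (hZ a) ih1 (hZi a), ?_, ?_⟩
    · rw [integral_add_sq_of_indepFun hi iS iZ iS2 iZ2 (hZ0 a), ih2, Finset.sum_insert ha, add_comm]
    · rw [Finset.sum_insert ha, Finset.sum_insert ha]
      -- Every partial variance is replaced by the same bound `B`, so the increments add up without
      -- any growth of the constant 6.
      have : (∫ ω, (∑ i ∈ s, Z i ω) ^ 2 ∂P) ^ (δ / 2) ≤ B ^ (δ / 2) := by
        rw [ih2]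
        refine Real.rpow_le_rpow (Finset.sum_nonneg fun i _ => h2 i) (by linarith [h2 a])
          (by linarith)
      have := mul_le_mul_of_nonneg_right this (h2 a)
      linarith

end Moments

/-! ### Anticoncentration from decay of the characteristic function -/

theorem integrable_comp_abs_of_Ioi {f : ℝ → ℝ} (hf : IntegrableOn f (Set.Ioi 0)) :
    Integrable fun x : ℝ => f |x| := by
  have h1 : IntegrableOn (fun x => f |x|) (Set.Ioi 0) :=
    hf.congr_fun (fun x hx => by rw [abs_of_pos hx]) measurableSet_Ioi
  have h2 : IntegrableOn (fun x => f |x|) (Set.Iic 0) := by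
    have m : MeasurableEmbedding fun x : ℝ => -x := (Homeomorph.neg ℝ).measurableEmbedding
    rw [← Measure.map_neg_eq_self (volume : Measure ℝ), m.integrableOn_map_iff]
    simpa [Function.comp_def] using Iff.mpr integrableOn_Ici_iff_integrableOn_Ioi h1
  rw [← integrableOn_univ, ← Set.Iic_union_Ioi (a := (0 : ℝ))]
  exact h2.union h1

theorem integrable_abs_rpow_neg_half_gaussianReal :
    Integrable (fun y : ℝ => |y| ^ (-(1 / 2) : ℝ)) (gaussianReal 0 1) := by
  rw [gaussianReal_of_var_ne_zero 0 one_ne_zero,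
    integrable_withDensity_iff (measurable_gaussianPDF 0 1)
      (ae_of_all _ fun x => ENNReal.ofReal_lt_top)]
  have h := integrableOn_rpow_mul_exp_neg_mul_sq (b := 1 / 2) (by norm_num)
    (s := (-(1 / 2) : ℝ)) (by norm_num)
  have h2 : Integrable fun x : ℝ => |x| ^ (-(1 / 2) : ℝ) * Real.exp (-(1 / 2) * |x| ^ 2) := by
    exact integrable_comp_abs_of_Ioi (f := fun x : ℝ => x ^ (-(1 / 2) : ℝ) *
      Real.exp (-(1 / 2) * x ^ 2)) h
  refine (h2.const_mul (√(2 * Real.pi))⁻¹).congr (ae_of_all _ fun x => ?_)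
  simp only [toReal_gaussianPDF, gaussianPDFReal, sq_abs]
  simp
  ring_nf

/-- The indicator of the interval is dominated by a Gaussian bump of width `h`, which is itself the
Fourier transform of `N(0,1)`. By Fubini the integral of the bump is a Gaussian average of the
characteristic function at `y / h`; the decay `|y / h| ^ (-1/2)` is integrable at the origin and
produces `h ^ (1/2)`. -/
theorem measureReal_Icc_le_of_charFun {ν : Measure ℝ} [IsProbabilityMeasure ν]
    (hν : ∀ s : ℝ, s ≠ 0 → ‖charFun ν s‖ ≤ |s| ^ (-(1 / 2) : ℝ)) (t : ℝ) {h : ℝ} (hh : 0 < h) :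
    ν.real (Set.Icc (t - h) (t + h)) ≤ Real.exp (1 / 2) *
      (∫ y, |y| ^ (-(1 / 2) : ℝ) ∂gaussianReal 0 1) * h ^ (1 / 2 : ℝ) := by
  set N : Measure ℝ := gaussianReal 0 1
  set F : ℝ → ℝ → ℂ := fun x y => Complex.exp (y * ((x - t) / h : ℝ) * Complex.I) with hF
  have hFm : Continuous (Function.uncurry F) := by
    simp only [hF, Function.uncurry_def]; fun_prop
  have hFn : ∀ x y, ‖F x y‖ = 1 := fun x y => by
    simp only [hF]
    rw [← Complex.ofReal_mul, Complex.norm_exp_ofReal_mul_I]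
  have hint : Integrable (Function.uncurry F) (ν.prod N) :=
    (integrable_const (1 : ℝ)).mono' hFm.aestronglyMeasurable
      (ae_of_all _ fun z => (hFn z.1 z.2).le)
  have e1 : ∀ x, ∫ y, F x y ∂N = (Real.exp (-((x - t) / h) ^ 2 / 2) : ℂ) := fun x => by
    have := charFun_gaussianReal (μ := 0) (v := 1) ((x - t) / h)
    rw [charFun_apply_real] at this
    simp only [hF]
    rw [show N = gaussianReal 0 1 from rfl]
    convert this using 2
    · ext y; ring_nf
    · push_cast; simp; ring_nf
  have e2 : ∀ y, y ≠ 0 → ‖∫ x, F x y ∂ν‖ ≤ h ^ (1 / 2 : ℝ) * |y| ^ (-(1 / 2) : ℝ) := fun y hy => by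
    have : ∀ x, F x y = Complex.exp (((-(y * t / h) : ℝ) : ℂ) * Complex.I) *
        Complex.exp ((y / h : ℝ) * x * Complex.I) := fun x => by
      simp only [hF]
      rw [← Complex.exp_add]
      congr 1
      push_cast
      field_simp
      ring
    simp_rw [this]
    rw [integral_const_mul, norm_mul, Complex.norm_exp_ofReal_mul_I, one_mul, ← charFun_apply_real]
    refine (hν (y / h) (by positivity)).trans (le_of_eq ?_)
    rw [abs_div, abs_of_pos hh, Real.div_rpow (abs_nonneg y) hh.le, Real.rpow_neg hh.le, div_inv_eq_mul,
      mul_comm]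
  have e3 : ∫ x, Real.exp (-((x - t) / h) ^ 2 / 2) ∂ν ≤
      h ^ (1 / 2 : ℝ) * ∫ y, |y| ^ (-(1 / 2) : ℝ) ∂N := by
    have : ((∫ x, Real.exp (-((x - t) / h) ^ 2 / 2) ∂ν : ℝ) : ℂ) = ∫ y, ∫ x, F x y ∂ν ∂N := by
      rw [← integral_integral_swap hint, ← integral_complex_ofReal]
      simp_rw [e1]
    calc ∫ x, Real.exp (-((x - t) / h) ^ 2 / 2) ∂ν
        ≤ ‖((∫ x, Real.exp (-((x - t) / h) ^ 2 / 2) ∂ν : ℝ) : ℂ)‖ := by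
          rw [Complex.norm_real]; exact le_abs_self _
      _ ≤ ∫ y, ‖∫ x, F x y ∂ν‖ ∂N := by rw [this]; exact norm_integral_le_integral_norm _
      _ ≤ ∫ y, h ^ (1 / 2 : ℝ) * |y| ^ (-(1 / 2) : ℝ) ∂N := by
          refine integral_mono_ae (hint.swap.integral_prod_left).norm
            (integrable_abs_rpow_neg_half_gaussianReal.const_mul _) ?_
          have : NullSingletonClass N := nullSingletonClass_gaussianReal one_ne_zero
          have h0 : ∀ᵐ y ∂N, y ≠ 0 := by
            simp [ae_iff]
          filter_upwards [h0] with y hy using e2 y hy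
      _ = _ := integral_const_mul _ _
  -- On the interval `|(x - t) / h| ≤ 1`, so the bump is at least `exp (-1/2)` there.
  have e4 : ν.real (Set.Icc (t - h) (t + h)) ≤
      ∫ x, Real.exp (1 / 2) * Real.exp (-((x - t) / h) ^ 2 / 2) ∂ν := by
    rw [← integral_indicator_one measurableSet_Icc]
    refine integral_mono ((integrable_const 1).indicator measurableSet_Icc) ?_ fun x => ?_
    · refine Integrable.const_mul ((integrable_const 1).mono' (by fun_prop)
        (ae_of_all _ fun x => ?_)) _
      rw [Real.norm_of_nonneg (Real.exp_pos _).le]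
      exact Real.exp_le_one_iff.2 (by nlinarith [sq_nonneg ((x - t) / h)])
    · by_cases hx : x ∈ Set.Icc (t - h) (t + h)
      · rw [Set.indicator_of_mem hx, ← Real.exp_add]
        refine Real.one_le_exp ?_
        have : ((x - t) / h) ^ 2 ≤ 1 := by
          rw [sq_le_one_iff_abs_le_one, abs_div, abs_of_pos hh, div_le_one hh, abs_le]
          constructor <;> linarith [hx.1, hx.2]
        linarith
      · rw [Set.indicator_of_notMem hx]; positivity
  rw [integral_const_mul] at e4
  calc _ ≤ _ := e4
    _ ≤ _ := mul_le_mul_of_nonneg_left e3 (Real.exp_pos _).le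
    _ = _ := by ring

/-! ### The characteristic function of a Gaussian quadratic form -/

/-- The integral is `(1 - 2ic) ^ (-1/2)`; only its modulus is needed. -/
theorem norm_integral_exp_sq_gaussianReal (c : ℝ) :
    ‖∫ x, Complex.exp ((c * x ^ 2 : ℝ) * Complex.I) ∂gaussianReal 0 1‖ =
      (1 + 4 * c ^ 2) ^ (-(1 / 4) : ℝ) := by
  rw [integral_gaussianReal_eq_integral_smul one_ne_zero]
  have e : ∀ x : ℝ, gaussianPDFReal 0 1 x • Complex.exp ((c * x ^ 2 : ℝ) * Complex.I) =
      (((√(2 * Real.pi))⁻¹ : ℝ) : ℂ) *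
        Complex.exp (-(1 / 2 - c * Complex.I) * (x : ℂ) ^ 2) := fun x => by
    rw [gaussianPDFReal, Complex.real_smul]
    push_cast
    rw [mul_assoc, ← Complex.exp_add]
    ring_nf
  simp_rw [e]
  rw [integral_const_mul, integral_gaussian_complex (by simp), norm_mul, Complex.norm_real]
  have h1 : ‖((1 : ℂ) / 2 - c * Complex.I)‖ = (1 / 4 + c ^ 2) ^ (1 / 2 : ℝ) := by
    rw [← Real.sqrt_eq_rpow, Complex.norm_def]
    congr 1
    simp [Complex.normSq_apply]
    ring
  have h2 : (1 / 2 : ℂ) = ((1 / 2 : ℝ) : ℂ) := by simp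
  rw [h2, Complex.norm_cpow_real, norm_div, Complex.norm_real]
  rw [← h2, h1, Real.norm_of_nonneg Real.pi_pos.le, Real.norm_of_nonneg (by positivity)]
  have h3 : (0 : ℝ) < 1 + 4 * c ^ 2 := by positivity
  have h4 : (1 / 4 + c ^ 2 : ℝ) = (1 + 4 * c ^ 2) / 4 := by ring
  rw [Real.div_rpow Real.pi_pos.le (by positivity), ← Real.rpow_mul (by positivity), h4,
    Real.div_rpow h3.le (by norm_num), Real.sqrt_eq_rpow, Real.mul_rpow (by norm_num) Real.pi_pos.le]
  have h5 : (4 : ℝ) ^ (1 / 2 * (1 / 2) : ℝ) = 2 ^ (1 / 2 : ℝ) := by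
    rw [show (4 : ℝ) = 2 ^ (2 : ℝ) by norm_num, ← Real.rpow_mul (by norm_num)]
    norm_num
  rw [h5, Real.rpow_neg h3.le]
  have : (0 : ℝ) < Real.pi ^ (1 / 2 : ℝ) := by positivity
  norm_num
  field_simp

theorem one_add_sum_le_prod_one_add {ι : Type*} (s : Finset ι) {b : ι → ℝ} (hb : ∀ i, 0 ≤ b i) :
    1 + ∑ i ∈ s, b i ≤ ∏ i ∈ s, (1 + b i) := by
  classical
  induction s using Finset.induction_on with
  | empty => simp
  | insert a s ha ih =>
    rw [Finset.sum_insert ha, Finset.prod_insert ha]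
    have := Finset.sum_nonneg fun i (_ : i ∈ s) => hb i
    nlinarith [hb a, mul_le_mul_of_nonneg_left ih (hb a), mul_nonneg (hb a) this]

/-- By independence the modulus is `∏ (1 + 4 s² a_j²) ^ (-1/4)`. The product is at least `1 + 4 s² ∑
a_j² ≥ s²`, so only the normalisation of `a` enters and the bound is free of the dimension. -/
theorem norm_charFun_quadratic_le {ι : Type*} [Fintype ι] {a : ι → ℝ} (ha : ∑ j, a j ^ 2 = 1)
    {s : ℝ} (hs : s ≠ 0) :
    ‖charFun ((Measure.pi fun _ : ι => gaussianReal 0 1).map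
      fun z => ∑ j, a j * (z j ^ 2 - 1)) s‖ ≤ |s| ^ (-(1 / 2) : ℝ) := by
  rw [charFun_apply_real, integral_map (Measurable.aemeasurable (by fun_prop)) (by fun_prop)]
  have e : ∀ z : ι → ℝ, Complex.exp (s * (∑ j, a j * (z j ^ 2 - 1) : ℝ) * Complex.I) =
      Complex.exp (((-s * ∑ j, a j : ℝ) : ℂ) * Complex.I) *
        ∏ j, Complex.exp (((s * a j) * z j ^ 2 : ℝ) * Complex.I) := fun z => by
    rw [← Complex.exp_sum, ← Complex.exp_add, ← Finset.sum_mul, ← Complex.ofReal_sum, ← add_mul,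
      ← Complex.ofReal_add, ← Complex.ofReal_mul]
    congr 3
    rw [Finset.mul_sum, Finset.mul_sum, ← Finset.sum_add_distrib]
    exact Finset.sum_congr rfl fun j _ => by ring
  simp_rw [e]
  rw [integral_const_mul, norm_mul, Complex.norm_exp_ofReal_mul_I, one_mul,
    integral_fintype_prod_eq_prod
      (f := fun j (x : ℝ) => Complex.exp (((s * a j) * x ^ 2 : ℝ) * Complex.I)), norm_prod]
  simp_rw [norm_integral_exp_sq_gaussianReal]
  rw [Real.finsetProd_rpow _ _ fun i _ => by positivity]
  have h1 : 1 + ∑ j, 4 * (s * a j) ^ 2 ≤ ∏ j, (1 + 4 * (s * a j) ^ 2) :=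
    one_add_sum_le_prod_one_add _ fun j => by positivity
  have h2 : ∑ j, 4 * (s * a j) ^ 2 = 4 * s ^ 2 := by
    simp_rw [mul_pow, ← mul_assoc]
    rw [← Finset.mul_sum, ha, mul_one]
  have h3 : s ^ 2 ≤ ∏ j, (1 + 4 * (s * a j) ^ 2) := by nlinarith [sq_nonneg s]
  refine (Real.rpow_le_rpow_of_nonpos (by positivity) h3 (by norm_num)).trans (le_of_eq ?_)
  rw [← sq_abs, ← Real.rpow_natCast, ← Real.rpow_mul (abs_nonneg s)]
  norm_num

/-- The concentration function of a normalized Gaussian quadratic form is `O(√h)`. -/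
theorem measureReal_quadratic_Icc_le {ι : Type*} [Fintype ι] {a : ι → ℝ} (ha : ∑ j, a j ^ 2 = 1)
    (t : ℝ) {h : ℝ} (hh : 0 < h) :
    (Measure.pi fun _ : ι => gaussianReal 0 1).real
      {z | ∑ j, a j * (z j ^ 2 - 1) ∈ Set.Icc (t - h) (t + h)} ≤ Real.exp (1 / 2) *
      (∫ y, |y| ^ (-(1 / 2) : ℝ) ∂gaussianReal 0 1) * h ^ (1 / 2 : ℝ) := by
  have hm : Measurable fun z : ι → ℝ => ∑ j, a j * (z j ^ 2 - 1) := by fun_prop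
  have := Measure.isProbabilityMeasure_map (μ := Measure.pi fun _ : ι => gaussianReal 0 1)
    hm.aemeasurable
  have := measureReal_Icc_le_of_charFun (fun s hs => norm_charFun_quadratic_le ha hs) t hh
  rwa [map_measureReal_apply hm measurableSet_Icc] at this

/-! ### Gaussian vectors with prescribed covariance eigenvalues -/

section Gaussian

variable {p : ℕ}

/-- The quadratic form with orthonormal eigenvectors `b` and eigenvalues `l`. -/
noncomputable def quadForm (b : OrthonormalBasis (Fin p) ℝ (Vec p)) (l : Fin p → ℝ) (x : Vec p) :
    ℝ := ∑ j, l j * inner ℝ (b j) x ^ 2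

/-- The vector with coordinates `√(l j) * z j` in the basis `b`. -/
noncomputable def gaussVec (b : OrthonormalBasis (Fin p) ℝ (Vec p)) (l : Fin p → ℝ)
    (z : Fin p → ℝ) : Vec p := ∑ j, z j • (√(l j) • b j)

/-- The law of a Gaussian vector whose covariance has eigenvectors `b` and eigenvalues `l`. -/
noncomputable def gaussLaw (b : OrthonormalBasis (Fin p) ℝ (Vec p)) (l : Fin p → ℝ) :
    Measure (Vec p) :=
  (Measure.pi fun _ : Fin p => gaussianReal 0 1).map (gaussVec b l)

/-- The absolute moments of a centred measure with covariance form `Q` and total variance `f₁`. -/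
structure HasProfile (Q : Vec p → ℝ) (f₁ q : ℝ) (μ : Measure (Vec p)) : Prop where
  prob : IsProbabilityMeasure μ
  integrable : Integrable (fun x => |‖x‖ ^ 2 - f₁| ^ q) μ
  mean : ∀ h, ∫ x, inner ℝ h x ∂μ = 0
  var : ∀ h, ∫ x, inner ℝ h x ^ 2 ∂μ = Q h
  trace : ∫ x, ‖x‖ ^ 2 ∂μ = f₁

theorem integral_comp_eval_gaussian (j : Fin p) {F : ℝ → ℝ} (hF : Measurable F) :
    ∫ z, F (z j) ∂(Measure.pi fun _ : Fin p => gaussianReal 0 1) = ∫ x, F x ∂gaussianReal 0 1 := by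
  have h := measurePreserving_eval (fun _ : Fin p => gaussianReal 0 1) j
  exact (integral_map h.measurable.aemeasurable hF.aestronglyMeasurable).symm.trans
    (by rw [h.map_eq])

theorem integrable_comp_eval_gaussian (j : Fin p) {F : ℝ → ℝ}
    (hF : Integrable F (gaussianReal 0 1)) :
    Integrable (fun z : Fin p → ℝ => F (z j)) (Measure.pi fun _ : Fin p => gaussianReal 0 1) :=
  (measurePreserving_eval (fun _ : Fin p => gaussianReal 0 1) j).integrable_comp_of_integrable hF

theorem integrable_abs_rpow_gaussianReal {r : ℝ} (hr : 0 ≤ r) :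
    Integrable (fun x : ℝ => |x| ^ r) (gaussianReal 0 1) := by
  have := (memLp_id_gaussianReal (μ := 0) (v := 1) r.toNNReal).integrable_norm_rpow'
  simpa [hr] using this

theorem integrable_abs_sq_sub_one_rpow_gaussianReal {r : ℝ} (hr : 0 ≤ r) :
    Integrable (fun x : ℝ => |x ^ 2 - 1| ^ r) (gaussianReal 0 1) := by
  have h1 : Integrable (fun x : ℝ => |x ^ 2| ^ r) (gaussianReal 0 1) := by
    refine (integrable_abs_rpow_gaussianReal (r := 2 * r) (by positivity)).congr
      (ae_of_all _ fun x => ?_)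
    simp only [abs_pow]
    rw [Real.rpow_mul (abs_nonneg x)]
    norm_num
  have := integrable_abs_add_rpow hr (by fun_prop) measurable_const h1
    (integrable_const (|(-1 : ℝ)| ^ r))
  simpa [sub_eq_add_neg] using this

theorem integral_sq_gaussianReal : ∫ x, x ^ 2 ∂gaussianReal 0 1 = 1 := by
  have := variance_fun_id_gaussianReal (μ := 0) (v := 1)
  rw [variance_of_integral_eq_zero (by fun_prop) (by simp)] at this
  simpa using this

variable (b : OrthonormalBasis (Fin p) ℝ (Vec p)) {l : Fin p → ℝ}

theorem measurable_gaussVec : Measurable (gaussVec b l) := by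
  unfold gaussVec; fun_prop

theorem continuous_quadForm : Continuous (quadForm b l) := by
  unfold quadForm; fun_prop

theorem quadForm_nonneg (hl : ∀ j, 0 ≤ l j) (x : Vec p) : 0 ≤ quadForm b l x :=
  Finset.sum_nonneg fun j _ => mul_nonneg (hl j) (sq_nonneg _)

theorem quadForm_smul (c : ℝ) (x : Vec p) : quadForm b l (c • x) = c ^ 2 * quadForm b l x := by
  simp only [quadForm, inner_smul_right, Finset.mul_sum]
  exact Finset.sum_congr rfl fun j _ => by ring

theorem inner_gaussVec (j : Fin p) (z : Fin p → ℝ) :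
    inner ℝ (b j) (gaussVec b l z) = √(l j) * z j := by
  simp [gaussVec, inner_sum, inner_smul_right, b.inner_eq_ite, mul_comm]

theorem quadForm_gaussVec (hl : ∀ j, 0 ≤ l j) (z : Fin p → ℝ) :
    quadForm b l (gaussVec b l z) = ∑ j, l j ^ 2 * z j ^ 2 := by
  simp only [quadForm, inner_gaussVec, mul_pow, Real.sq_sqrt (hl _)]
  exact Finset.sum_congr rfl fun j _ => by ring

theorem norm_sq_gaussVec (hl : ∀ j, 0 ≤ l j) (z : Fin p → ℝ) :
    ‖gaussVec b l z‖ ^ 2 = ∑ j, l j * z j ^ 2 := by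
  rw [← b.sum_sq_inner_right]
  simp only [inner_gaussVec, mul_pow, Real.sq_sqrt (hl _)]

instance isProbabilityMeasure_gaussLaw : IsProbabilityMeasure (gaussLaw b l) :=
  Measure.isProbabilityMeasure_map (measurable_gaussVec b).aemeasurable

theorem integral_gaussLaw {F : Vec p → ℝ} (hF : Measurable F) :
    ∫ y, F y ∂gaussLaw b l =
      ∫ z, F (gaussVec b l z) ∂(Measure.pi fun _ : Fin p => gaussianReal 0 1) :=
  integral_map (measurable_gaussVec b).aemeasurable hF.aestronglyMeasurable

theorem integrable_gaussLaw {F : Vec p → ℝ} (hF : Measurable F) :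
    Integrable F (gaussLaw b l) ↔ Integrable (fun z => F (gaussVec b l z))
      (Measure.pi fun _ : Fin p => gaussianReal 0 1) :=
  integrable_map_measure hF.aestronglyMeasurable (measurable_gaussVec b).aemeasurable

theorem charFun_gaussLaw (hl : ∀ j, 0 ≤ l j) (t : Vec p) :
    charFun (gaussLaw b l) t = Complex.exp (-(quadForm b l t : ℂ) / 2) := by
  rw [charFun_apply, gaussLaw, integral_map (measurable_gaussVec b).aemeasurable
    (Measurable.aestronglyMeasurable (by fun_prop))]
  simp_rw [gaussVec, sum_inner, Complex.ofReal_sum, Finset.sum_mul, Complex.exp_sum,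
    integral_fintype_prod_eq_prod
      (f := fun i (x : ℝ) ↦ Complex.exp ((inner ℝ (x • (√(l i) • b i)) t : ℝ) * Complex.I)),
    real_inner_smul_left, mul_comm _ (√(l _) * inner ℝ (b _) t), Complex.ofReal_mul,
    ← Complex.ofReal_mul (√(l _)), ← charFun_apply_real, charFun_gaussianReal, ← Complex.exp_sum]
  congr 1
  simp only [quadForm, Complex.ofReal_sum, neg_div, Finset.sum_div, ← Finset.sum_neg_distrib]
  refine Finset.sum_congr rfl fun j _ => ?_
  have : ((√(l j) : ℝ) : ℂ) ^ 2 = l j := by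
    rw [← Complex.ofReal_pow, Real.sq_sqrt (hl j)]
  push_cast
  rw [mul_pow, this]
  simp

theorem map_inner_gaussLaw (hl : ∀ j, 0 ≤ l j) (h : Vec p) :
    (gaussLaw b l).map (fun y => inner ℝ h y) =
      (gaussianReal 0 1).map (fun x => √(quadForm b l h) * x) := by
  have hm : Measurable fun y : Vec p => inner ℝ h y := by fun_prop
  have := Measure.isProbabilityMeasure_map (μ := gaussLaw b l) hm.aemeasurable
  have := Measure.isProbabilityMeasure_map (μ := gaussianReal 0 1)
    (f := fun x => √(quadForm b l h) * x) (by fun_prop)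
  refine Measure.ext_of_charFun ?_
  ext s
  rw [gaussianReal_map_const_mul, charFun_gaussianReal, charFun_apply_real,
    integral_map hm.aemeasurable (by fun_prop)]
  have e := charFun_gaussLaw b hl (s • h)
  rw [charFun_apply] at e
  have e2 : ∀ y : Vec p, (s : ℂ) * (inner ℝ h y : ℝ) = (inner ℝ y (s • h) : ℝ) := fun y => by
    rw [real_inner_smul_right, real_inner_comm]; push_cast; ring
  simp_rw [e2, e, quadForm_smul]
  congr 1
  have e3 : ((√(quadForm b l h) : ℝ) : ℂ) ^ 2 = quadForm b l h := by
    rw [← Complex.ofReal_pow, Real.sq_sqrt (quadForm_nonneg b hl h)]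
  push_cast
  rw [e3]
  ring

theorem integral_comp_inner_gaussLaw (hl : ∀ j, 0 ≤ l j) (h : Vec p) {F : ℝ → ℝ}
    (hF : Measurable F) :
    ∫ y, F (inner ℝ h y) ∂gaussLaw b l =
      ∫ x, F (√(quadForm b l h) * x) ∂gaussianReal 0 1 := by
  rw [← integral_map (μ := gaussLaw b l) (φ := fun y => inner ℝ h y)
      (Measurable.aemeasurable (by fun_prop))
      hF.aestronglyMeasurable, map_inner_gaussLaw b hl, integral_map (by fun_prop)
      hF.aestronglyMeasurable]

theorem integral_abs_inner_rpow_gaussLaw (hl : ∀ j, 0 ≤ l j) (h : Vec p) (q : ℝ) :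
    ∫ y, |inner ℝ h y| ^ q ∂gaussLaw b l =
      quadForm b l h ^ (q / 2) * ∫ x, |x| ^ q ∂gaussianReal 0 1 := by
  rw [integral_comp_inner_gaussLaw b hl h (F := fun x => |x| ^ q) (by fun_prop),
    ← integral_const_mul]
  congr with x
  rw [abs_mul, Real.mul_rpow (abs_nonneg _) (abs_nonneg _), abs_of_nonneg (Real.sqrt_nonneg _),
    Real.sqrt_eq_rpow, ← Real.rpow_mul (quadForm_nonneg b hl h)]
  ring_nf

/-- In eigencoordinates `Q = f² ∑ (l_j²/f²) z_j²`, a weighted mean; convexity of the power `q / 2`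
reduces the moment to that of one Gaussian coordinate, without dependence on `p`. -/
theorem integral_quadForm_rpow_gaussLaw (hl : ∀ j, 0 ≤ l j) {f q : ℝ} (hf : 0 < f)
    (hlf : ∑ j, l j ^ 2 = f ^ 2) (hq : 2 ≤ q) :
    Integrable (fun y => quadForm b l y ^ (q / 2)) (gaussLaw b l) ∧
    ∫ y, quadForm b l y ^ (q / 2) ∂gaussLaw b l ≤ f ^ q * ∫ x, |x| ^ q ∂gaussianReal 0 1 := by
  have hm : Measurable fun y => quadForm b l y ^ (q / 2) :=
    ((continuous_quadForm b).rpow_const fun _ => Or.inr (by linarith)).measurable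
  rw [integrable_gaussLaw b hm, integral_gaussLaw b hm]
  simp_rw [quadForm_gaussVec b hl]
  have hi : ∀ j : Fin p, Integrable (fun z : Fin p → ℝ => l j ^ 2 / f ^ 2 * |z j| ^ q)
      (Measure.pi fun _ : Fin p => gaussianReal 0 1) := fun j =>
    (integrable_comp_eval_gaussian j (integrable_abs_rpow_gaussianReal (by linarith))).const_mul _
  have hi' := (integrable_finsetSum Finset.univ fun j _ => hi j).const_mul (f ^ q)
  have hle : ∀ z : Fin p → ℝ, (∑ j, l j ^ 2 * z j ^ 2) ^ (q / 2) ≤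
      f ^ q * ∑ j, l j ^ 2 / f ^ 2 * |z j| ^ q := fun z => by
    have e : ∑ j, l j ^ 2 * z j ^ 2 = f ^ 2 * ∑ j, l j ^ 2 / f ^ 2 * z j ^ 2 := by
      rw [Finset.mul_sum]
      exact Finset.sum_congr rfl fun j _ => by field_simp
    have e2 : (f ^ 2) ^ (q / 2) = f ^ q := by
      rw [← Real.rpow_natCast, ← Real.rpow_mul hf.le]
      congr 1; push_cast; ring
    have e3 : ∀ x : ℝ, (x ^ 2) ^ (q / 2) = |x| ^ q := fun x => by
      rw [← sq_abs, ← Real.rpow_natCast, ← Real.rpow_mul (abs_nonneg x)]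
      congr 1; push_cast; ring
    rw [e, Real.mul_rpow (by positivity) (Finset.sum_nonneg fun j _ => by positivity), e2]
    gcongr
    simp_rw [← e3]
    refine Real.rpow_arith_mean_le_arith_mean_rpow _ _ _ (fun j _ => by positivity) ?_
      (fun j _ => by positivity) (by linarith)
    rw [← Finset.sum_div, hlf, div_self (by positivity)]
  have hnn : ∀ z : Fin p → ℝ, 0 ≤ (∑ j, l j ^ 2 * z j ^ 2) ^ (q / 2) := fun z =>
    Real.rpow_nonneg (Finset.sum_nonneg fun j _ => by positivity) _
  have hint : Integrable (fun z : Fin p → ℝ => (∑ j, l j ^ 2 * z j ^ 2) ^ (q / 2))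
      (Measure.pi fun _ : Fin p => gaussianReal 0 1) :=
    hi'.mono' (Measurable.aestronglyMeasurable (by fun_prop)) (ae_of_all _ fun z => by
      rw [Real.norm_of_nonneg (hnn z)]; exact hle z)
  refine ⟨hint, (integral_mono hint hi' hle).trans (le_of_eq ?_)⟩
  rw [integral_const_mul, integral_finsetSum _ fun j _ => hi j]
  simp_rw [integral_const_mul]
  have : ∀ j : Fin p, ∫ z, |z j| ^ q ∂(Measure.pi fun _ : Fin p => gaussianReal 0 1) =
      ∫ x, |x| ^ q ∂gaussianReal 0 1 := fun j =>
    integral_comp_eval_gaussian j (F := fun x => |x| ^ q) (by fun_prop)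
  simp_rw [this]
  rw [← Finset.sum_mul, ← Finset.sum_div, hlf, div_self (by positivity), one_mul]

theorem norm_sq_gaussVec_sub (hl : ∀ j, 0 ≤ l j) (z : Fin p → ℝ) :
    ‖gaussVec b l z‖ ^ 2 - ∑ j, l j = ∑ j, l j * (z j ^ 2 - 1) := by
  rw [norm_sq_gaussVec b hl, ← Finset.sum_sub_distrib]
  exact Finset.sum_congr rfl fun j _ => by ring

/-- The `(2+δ)`-th and second moments of `‖Y‖² - E‖Y‖²` for a Gaussian vector `Y`. -/
theorem moments_norm_sq_gaussLaw {δ : ℝ} (hδ0 : 0 < δ) (hδ1 : δ ≤ 1) :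
    ∃ C : ℝ, 0 < C ∧ ∀ {p : ℕ} (b : OrthonormalBasis (Fin p) ℝ (Vec p)) {l : Fin p → ℝ}
      (_ : ∀ j, 0 ≤ l j) {f : ℝ} (_ : 0 < f) (_ : ∑ j, l j ^ 2 = f ^ 2),
      HasProfile (quadForm b l) (∑ j, l j) (2 + δ) (gaussLaw b l) ∧
      ∫ y, (‖y‖ ^ 2 - ∑ j, l j) ^ 2 ∂gaussLaw b l ≤ C * f ^ 2 ∧
      ∫ y, |‖y‖ ^ 2 - ∑ j, l j| ^ (2 + δ) ∂gaussLaw b l ≤ C * f ^ (2 + δ) := by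
  set κ₂ := ∫ x : ℝ, (x ^ 2 - 1) ^ 2 ∂gaussianReal 0 1
  set κ := ∫ x : ℝ, |x ^ 2 - 1| ^ (2 + δ) ∂gaussianReal 0 1
  have hκ₂ : 0 ≤ κ₂ := integral_nonneg fun x => sq_nonneg (x ^ 2 - 1)
  have hκ : 0 ≤ κ := integral_nonneg fun x => by positivity
  refine ⟨κ₂ + 6 * (κ₂ ^ (δ / 2) * κ₂ + κ) + 1, by positivity, ?_⟩
  intro p b l hl f hf hlf
  set N := Measure.pi fun _ : Fin p => gaussianReal 0 1
  have i2 : Integrable (fun x : ℝ => x ^ 2) (gaussianReal 0 1) := by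
    simpa using integrable_abs_rpow_gaussianReal (r := 2) zero_le_two
  have hZm : ∀ j, Measurable fun z : Fin p → ℝ => l j * (z j ^ 2 - 1) := fun j => by fun_prop
  have hind : iIndepFun (fun j (z : Fin p → ℝ) => l j * (z j ^ 2 - 1)) N :=
    iIndepFun_pi (X := fun j (x : ℝ) => l j * (x ^ 2 - 1)) fun j =>
      Measurable.aemeasurable (by fun_prop)
  have absmul : ∀ j (x : ℝ), |l j * (x ^ 2 - 1)| ^ (2 + δ) =
      l j ^ (2 + δ) * |x ^ 2 - 1| ^ (2 + δ) := fun j x => by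
    rw [abs_mul, abs_of_nonneg (hl j), Real.mul_rpow (hl j) (abs_nonneg _)]
  have hZi : ∀ j, Integrable (fun z : Fin p → ℝ => |l j * (z j ^ 2 - 1)| ^ (2 + δ)) N := fun j => by
    simp_rw [absmul]
    exact (integrable_comp_eval_gaussian j (integrable_abs_sq_sub_one_rpow_gaussianReal
      (by linarith))).const_mul _
  have hZ0 : ∀ j, ∫ z : Fin p → ℝ, l j * (z j ^ 2 - 1) ∂N = 0 := fun j => by
    rw [integral_const_mul, integral_comp_eval_gaussian j (F := fun x => x ^ 2 - 1) (by fun_prop),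
      integral_sub i2 (integrable_const _), integral_sq_gaussianReal]
    simp
  have hZ2 : ∀ j, ∫ z : Fin p → ℝ, (l j * (z j ^ 2 - 1)) ^ 2 ∂N = l j ^ 2 * κ₂ := fun j => by
    simp_rw [mul_pow]
    rw [integral_const_mul,
      integral_comp_eval_gaussian j (F := fun x => (x ^ 2 - 1) ^ 2) (by fun_prop)]
  have hZq : ∀ j, ∫ z : Fin p → ℝ, |l j * (z j ^ 2 - 1)| ^ (2 + δ) ∂N = l j ^ (2 + δ) * κ :=
    fun j => by
      simp_rw [absmul]
      rw [integral_const_mul,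
        integral_comp_eval_gaussian j (F := fun x => |x ^ 2 - 1| ^ (2 + δ)) (by fun_prop)]
  -- `‖Y‖² - E‖Y‖²` is a sum of the independent centred variables `l j * (z j ^ 2 - 1)`, so
  -- Rosenthal's inequality applies with this total variance.
  have s2 : ∑ j, ∫ z : Fin p → ℝ, (l j * (z j ^ 2 - 1)) ^ 2 ∂N = f ^ 2 * κ₂ := by
    simp_rw [hZ2]; rw [← Finset.sum_mul, hlf]
  obtain ⟨r1, r2, r3⟩ := integral_abs_sum_rpow_le hδ0 hδ1 hind hZm hZi hZ0 Finset.univ s2.le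
  -- Each `l j` is at most `f`, so a factor `f ^ δ` comes out of the sum.
  have hlq : ∑ j, l j ^ (2 + δ) ≤ f ^ (2 + δ) := by
    have e : ∀ x : ℝ, 0 ≤ x → x ^ (2 + δ) = x ^ 2 * x ^ δ := fun x hx => by
      rw [Real.rpow_add_of_nonneg hx zero_le_two hδ0.le]; norm_num
    rw [e f hf.le, ← hlf, Finset.sum_mul]
    refine Finset.sum_le_sum fun j _ => ?_
    rw [e _ (hl j)]
    have : l j ≤ f := by
      refine le_of_sq_le_sq ?_ hf.le
      rw [← hlf]
      exact Finset.single_le_sum (f := fun j => l j ^ 2) (fun i _ => sq_nonneg _)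
        (Finset.mem_univ j)
    have := Real.rpow_le_rpow (hl j) this hδ0.le
    gcongr
  have hfq : (f ^ 2) ^ (δ / 2) * f ^ 2 = f ^ (2 + δ) := by
    rw [← Real.rpow_natCast, ← Real.rpow_mul hf.le, ← Real.rpow_add hf]
    congr 1; push_cast; ring
  have m1 : Measurable fun y : Vec p => |‖y‖ ^ 2 - ∑ j, l j| ^ (2 + δ) := by fun_prop
  have m2 : Measurable fun y : Vec p => (‖y‖ ^ 2 - ∑ j, l j) ^ 2 := by fun_prop
  refine ⟨⟨inferInstance, ?_, fun h => ?_, fun h => ?_, ?_⟩, ?_, ?_⟩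
  · rw [integrable_gaussLaw b m1]
    simp_rw [norm_sq_gaussVec_sub b hl]
    exact r1
  · rw [integral_comp_inner_gaussLaw b hl h (F := fun x => x) (by fun_prop), integral_const_mul]
    simp
  · rw [integral_comp_inner_gaussLaw b hl h (F := fun x => x ^ 2) (by fun_prop)]
    simp_rw [mul_pow]
    rw [integral_const_mul, integral_sq_gaussianReal, Real.sq_sqrt (quadForm_nonneg b hl h),
      mul_one]
  · rw [integral_gaussLaw b (by fun_prop)]
    simp_rw [norm_sq_gaussVec b hl]
    rw [integral_finsetSum _ fun j _ => (integrable_comp_eval_gaussian j i2).const_mul _]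
    simp_rw [integral_const_mul]
    refine Finset.sum_congr rfl fun j _ => ?_
    rw [integral_comp_eval_gaussian j (F := fun x => x ^ 2) (by fun_prop),
      integral_sq_gaussianReal, mul_one]
  · rw [integral_gaussLaw b m2]
    simp_rw [norm_sq_gaussVec_sub b hl]
    rw [r2, s2, mul_comm]
    gcongr
    have : 0 ≤ κ₂ ^ (δ / 2) * κ₂ + κ := by positivity
    linarith
  · rw [integral_gaussLaw b m1]
    simp_rw [norm_sq_gaussVec_sub b hl]
    refine r3.trans ?_
    rw [s2]
    simp_rw [hZq]
    rw [← Finset.sum_mul, Real.mul_rpow (by positivity) hκ₂]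
    have h1 := mul_le_mul_of_nonneg_right hlq hκ
    have h2 : (f ^ 2) ^ (δ / 2) * κ₂ ^ (δ / 2) * (f ^ 2 * κ₂) =
        f ^ (2 + δ) * (κ₂ ^ (δ / 2) * κ₂) := by rw [← hfq]; ring
    rw [h2]
    have h3 : 0 ≤ f ^ (2 + δ) := by positivity
    nlinarith [mul_nonneg h3 hκ₂]

end Gaussian

/-! ### Partial sums as convolutions -/

section Convolution

variable {p : ℕ}

/-- The law of a sum of `k` independent vectors with law `μ`. -/
noncomputable def convPow (μ : Measure (Vec p)) : ℕ → Measure (Vec p)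
  | 0 => Measure.dirac 0
  | k + 1 => convPow μ k ∗ μ

instance isProbabilityMeasure_convPow (μ : Measure (Vec p)) [IsProbabilityMeasure μ] (k : ℕ) :
    IsProbabilityMeasure (convPow μ k) := by
  induction k with
  | zero => rw [convPow]; infer_instance
  | succ k ih => rw [convPow]; infer_instance

theorem integral_conv_eq_integral_prod (H ν : Measure (Vec p)) {F : Vec p → ℝ}
    (hF : Measurable F) : ∫ z, F z ∂(H ∗ ν) = ∫ w, F (w.1 + w.2) ∂(H.prod ν) :=
  integral_map (by fun_prop) hF.aestronglyMeasurable

theorem charFun_convPow (μ : Measure (Vec p)) [IsProbabilityMeasure μ] (k : ℕ) (t : Vec p) :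
    charFun (convPow μ k) t = charFun μ t ^ k := by
  induction k with
  | zero => simp [convPow, charFun_apply]
  | succ k ih => rw [convPow, charFun_conv, ih, pow_succ]

theorem convPow_gaussLaw (b : OrthonormalBasis (Fin p) ℝ (Vec p)) {l : Fin p → ℝ}
    (hl : ∀ j, 0 ≤ l j) (n : ℕ) :
    convPow (gaussLaw b l) n = (gaussLaw b l).map (fun y => √n • y) := by
  have := Measure.isProbabilityMeasure_map (μ := gaussLaw b l) (f := fun y => √n • y)
    (by fun_prop)
  refine Measure.ext_of_charFun ?_
  ext t
  rw [charFun_convPow, charFun_gaussLaw b hl, charFun_apply, integral_map (by fun_prop)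
    (Measurable.aestronglyMeasurable (by fun_prop))]
  have e := charFun_gaussLaw b hl (√n • t)
  rw [charFun_apply] at e
  simp_rw [real_inner_smul_left]
  simp_rw [real_inner_smul_right] at e
  rw [e, ← Complex.exp_nat_mul, quadForm_smul, Real.sq_sqrt (Nat.cast_nonneg n)]
  congr 1
  push_cast; ring

/-- The profile puts `‖x‖² - f₁`, hence `‖x‖²`, in `L^q`; so even the moment of order `2q` of the
norm is finite. -/
theorem HasProfile.integrable_norm_rpow {Q : Vec p → ℝ} {f₁ q : ℝ} {μ : Measure (Vec p)}
    (h : HasProfile Q f₁ q μ) (hq : 0 ≤ q) : Integrable (fun x => ‖x‖ ^ q) μ := by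
  have := h.prob
  have h1 := integrable_abs_add_rpow hq (by fun_prop) measurable_const h.integrable
    (integrable_const (|f₁| ^ q))
  simp only [sub_add_cancel] at h1
  have h2 := integrable_abs_rpow_of_le (r := q / 2) (by linarith) (by linarith)
    (U := fun x : Vec p => ‖x‖ ^ 2) (by fun_prop) h1
  refine h2.congr (ae_of_all _ fun x => ?_)
  simp only [abs_pow, abs_norm]
  rw [← Real.rpow_natCast, ← Real.rpow_mul (norm_nonneg x)]
  congr 1; push_cast; ring

theorem integrable_abs_inner_rpow {μ : Measure (Vec p)} {q : ℝ} (hq : 0 ≤ q)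
    (h : Integrable (fun x => ‖x‖ ^ q) μ) (y : Vec p) :
    Integrable (fun x => |inner ℝ y x| ^ q) μ :=
  (h.const_mul (‖y‖ ^ q)).mono' (Measurable.aestronglyMeasurable (by fun_prop))
    (ae_of_all _ fun x => by
      rw [Real.norm_of_nonneg (by positivity), ← Real.mul_rpow (norm_nonneg _) (norm_nonneg _)]
      exact Real.rpow_le_rpow (abs_nonneg _) (abs_real_inner_le_norm y x) hq)

theorem integrable_abs_inner_rpow_prod {H ν : Measure (Vec p)} [SFinite H] [SFinite ν] {q : ℝ}
    (hq : 0 ≤ q) (hH : Integrable (fun x => ‖x‖ ^ q) H) (hν : Integrable (fun x => ‖x‖ ^ q) ν) :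
    Integrable (fun w : Vec p × Vec p => |inner ℝ w.1 w.2| ^ q) (H.prod ν) :=
  (hH.mul_prod hν).mono' (Measurable.aestronglyMeasurable (by fun_prop))
    (ae_of_all _ fun w => by
      rw [Real.norm_of_nonneg (by positivity), ← Real.mul_rpow (norm_nonneg _) (norm_nonneg _)]
      exact Real.rpow_le_rpow (abs_nonneg _) (abs_real_inner_le_norm w.1 w.2) hq)

/-- Moment bounds for a sum of `N ≤ n` independent vectors with covariance form `Q`, whose
marginal absolute moments are bounded by `ρ`. -/
structure IsPartialSum (Q ρ : Vec p → ℝ) (δ : ℝ) (n N : ℕ) (H : Measure (Vec p)) : Prop where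
  prob : IsProbabilityMeasure H
  integrable : Integrable (fun x => ‖x‖ ^ (2 + δ)) H
  var : ∀ x, ∫ y, inner ℝ x y ^ 2 ∂H = N * Q x
  moment : ∀ x, ∫ y, |inner ℝ x y| ^ (2 + δ) ∂H ≤ 6 * (N * ((n * Q x) ^ (δ / 2) * Q x + ρ x))

theorem isPartialSum_dirac (Q ρ : Vec p → ℝ) {δ : ℝ} (hδ0 : 0 < δ) (n : ℕ) :
    IsPartialSum Q ρ δ n 0 (Measure.dirac 0) where
  prob := inferInstance
  integrable := integrable_dirac (by simp [enorm])
  var x := by simp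
  moment x := by simp [Real.zero_rpow (show 2 + δ ≠ 0 by positivity)]

/-- The Rosenthal step applied to each one-dimensional marginal. Keeping `n`, not `N`, inside the
power `δ / 2` makes the moment bound linear in `N`. -/
theorem IsPartialSum.conv {Q ρ : Vec p → ℝ} {f₁ δ : ℝ} (hδ0 : 0 < δ) (hδ1 : δ ≤ 1) {n N : ℕ}
    (hN : N ≤ n) (hQ : ∀ x, 0 ≤ Q x) {H ν : Measure (Vec p)} (hH : IsPartialSum Q ρ δ n N H)
    (hν : HasProfile Q f₁ (2 + δ) ν) (hρ : ∀ x, ∫ y, |inner ℝ x y| ^ (2 + δ) ∂ν ≤ ρ x) :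
    IsPartialSum Q ρ δ n (N + 1) (H ∗ ν) := by
  have := hH.prob
  have := hν.prob
  have hq : 0 ≤ 2 + δ := by linarith
  have hνq := hν.integrable_norm_rpow hq
  have key : ∀ x : Vec p, IndepFun (fun w : Vec p × Vec p => inner ℝ x w.1)
      (fun w : Vec p × Vec p => inner ℝ x w.2) (H.prod ν) := fun x =>
    indepFun_prod (X := fun y : Vec p => inner ℝ x y) (Y := fun y : Vec p => inner ℝ x y)
      (by fun_prop) (by fun_prop)
  have i1 : ∀ x : Vec p, Integrable (fun w : Vec p × Vec p => |inner ℝ x w.1| ^ (2 + δ))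
      (H.prod ν) := fun x => (integrable_abs_inner_rpow hq hH.integrable x).comp_fst ν
  have i2 : ∀ x : Vec p, Integrable (fun w : Vec p × Vec p => |inner ℝ x w.2| ^ (2 + δ))
      (H.prod ν) := fun x => (integrable_abs_inner_rpow hq hνq x).comp_snd H
  have m1 : ∀ x : Vec p, Measurable (fun w : Vec p × Vec p => inner ℝ x w.1) := fun x => by fun_prop
  have m2 : ∀ x : Vec p, Measurable (fun w : Vec p × Vec p => inner ℝ x w.2) := fun x => by fun_prop
  have e1 : ∀ (x : Vec p) {F : ℝ → ℝ} (_ : Measurable F),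
      ∫ w, F (inner ℝ x w.1) ∂(H.prod ν) = ∫ y, F (inner ℝ x y) ∂H := fun x F hF => by
    rw [integral_fun_fst (fun y => F (inner ℝ x y))]; simp
  have e2 : ∀ (x : Vec p) {F : ℝ → ℝ} (_ : Measurable F),
      ∫ w, F (inner ℝ x w.2) ∂(H.prod ν) = ∫ y, F (inner ℝ x y) ∂ν := fun x F hF => by
    rw [integral_fun_snd (fun y => F (inner ℝ x y))]; simp
  have z2 : ∀ x : Vec p, ∫ w : Vec p × Vec p, inner ℝ x w.2 ∂(H.prod ν) = 0 := fun x => by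
    rw [e2 x (F := fun t => t) (by fun_prop), hν.mean]
  refine ⟨inferInstance, ?_, fun x => ?_, fun x => ?_⟩
  · have hm : Measurable fun x : Vec p => ‖x‖ ^ (2 + δ) := by fun_prop
    refine (integrable_map_measure hm.aestronglyMeasurable (by fun_prop)).2 ?_
    refine ((hH.integrable.comp_fst ν).add (hνq.comp_snd H) |>.const_mul (2 ^ (2 + δ))).mono'
      (Measurable.aestronglyMeasurable (by fun_prop)) (ae_of_all _ fun w => ?_)
    simp only [Function.comp, Pi.add_apply]
    rw [Real.norm_of_nonneg (by positivity)]
    have h1 := abs_add_rpow_le_mul hq ‖w.1‖ ‖w.2‖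
    rw [abs_norm, abs_norm, abs_of_nonneg (by positivity)] at h1
    exact (Real.rpow_le_rpow (norm_nonneg _) (norm_add_le _ _) hq).trans h1
  · rw [integral_conv_eq_integral_prod H ν (by fun_prop)]
    simp_rw [inner_add_right]
    rw [integral_add_sq_of_indepFun (key x) (integrable_of_abs_rpow (by linarith) (m1 x) (i1 x))
      (integrable_of_abs_rpow (by linarith) (m2 x) (i2 x))
      (integrable_sq_of_abs_rpow (by linarith) (m1 x) (i1 x))
      (integrable_sq_of_abs_rpow (by linarith) (m2 x) (i2 x)) (z2 x),
      e1 x (F := fun t => t ^ 2) (by fun_prop), e2 x (F := fun t => t ^ 2) (by fun_prop),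
      hH.var, hν.var]
    push_cast; ring
  · rw [integral_conv_eq_integral_prod H ν (by fun_prop)]
    simp_rw [inner_add_right]
    refine (integral_abs_add_rpow_le hδ0 hδ1 (key x) (m1 x) (m2 x) (i1 x) (i2 x) (z2 x)).trans ?_
    rw [e1 x (F := fun t => |t| ^ (2 + δ)) (by fun_prop),
      e2 x (F := fun t => |t| ^ (2 + δ)) (by fun_prop),
      e1 x (F := fun t => t ^ 2) (by fun_prop), e2 x (F := fun t => t ^ 2) (by fun_prop),
      hH.var, hν.var]
    have h1 := hH.moment x
    have h2 := hρ x
    have h3 : (N * Q x) ^ (δ / 2) ≤ (n * Q x) ^ (δ / 2) := by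
      refine Real.rpow_le_rpow (mul_nonneg (by positivity) (hQ x)) ?_ (by linarith)
      exact mul_le_mul_of_nonneg_right (by exact_mod_cast hN) (hQ x)
    have h4 := mul_le_mul_of_nonneg_right h3 (hQ x)
    push_cast
    linarith

/-- The hybrid sums of Lindeberg's method: `k` original and `m` Gaussian summands. A single `ρ`
dominates both marginal moments, so all hybrids obey the same bounds. -/
theorem isPartialSum_convPow_conv_convPow {Q ρ : Vec p → ℝ} {f₁ δ : ℝ} (hδ0 : 0 < δ) (hδ1 : δ ≤ 1)
    (hQ : ∀ x, 0 ≤ Q x) {μ γ : Measure (Vec p)} (hμ : HasProfile Q f₁ (2 + δ) μ)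
    (hγ : HasProfile Q f₁ (2 + δ) γ) (hμρ : ∀ x, ∫ y, |inner ℝ x y| ^ (2 + δ) ∂μ ≤ ρ x)
    (hγρ : ∀ x, ∫ y, |inner ℝ x y| ^ (2 + δ) ∂γ ≤ ρ x) {n : ℕ} (k m : ℕ) (hkm : k + m ≤ n) :
    IsPartialSum Q ρ δ n (k + m) (convPow μ k ∗ convPow γ m) := by
  have := hμ.prob
  have := hγ.prob
  induction m with
  | zero =>
    rw [convPow, Measure.conv_dirac_zero, add_zero]
    induction k with
    | zero => exact isPartialSum_dirac Q ρ hδ0 n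
    | succ k ih => exact IsPartialSum.conv hδ0 hδ1 (by omega) hQ (ih (by omega)) hμ hμρ
  | succ m ih =>
    rw [convPow, ← Measure.conv_assoc]
    exact IsPartialSum.conv (N := k + m) hδ0 hδ1 (by omega) hQ (ih (by omega)) hγ hγρ

end Convolution

/-! ### Replacing one summand -/

section Lindeberg

variable {p : ℕ}

/-- The heart of the replacement. The comparison integral over `H` involves `ν` only through `Q` and
`f₁`, hence is common to two summands with equal covariance. It contains only the part `2 θ² (h·x)²`
of the quadratic Taylor term; the rest of that term is counted as error. -/
theorem abs_integral_conv_sub_le {g g₁ g₂ : ℝ → ℝ} {M δ : ℝ} (hg : IsTaylorCutoff g g₁ g₂ M)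
    (hδ0 : 0 < δ) (hδ1 : δ ≤ 1) {Q : Vec p → ℝ} {f₁ : ℝ} {H ν : Measure (Vec p)}
    [IsProbabilityMeasure H] (hH : Integrable (fun x => ‖x‖ ^ (2 + δ)) H)
    (hν : HasProfile Q f₁ (2 + δ) ν) (θ s : ℝ) :
    |∫ z, g (θ * (‖z‖ ^ 2 - s)) ∂(H ∗ ν) -
      ∫ h, (g (θ * (‖h‖ ^ 2 + f₁ - s)) + 2 * θ ^ 2 * (g₂ (θ * (‖h‖ ^ 2 + f₁ - s)) * Q h)) ∂H| ≤
      M * (∫ w, |θ * (2 * inner ℝ w.1 w.2 + (‖w.2‖ ^ 2 - f₁))| ^ (2 + δ) ∂(H.prod ν)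
        + 2 * θ ^ 2 * ∫ w, |inner ℝ w.1 w.2 * (‖w.2‖ ^ 2 - f₁)| ∂(H.prod ν)
        + 1 / 2 * θ ^ 2 * ∫ x, (‖x‖ ^ 2 - f₁) ^ 2 ∂ν) := by
  have := hν.prob
  have hq : 0 ≤ 2 + δ := by linarith
  have cg := hg.cont
  have cg₁ := hg.cont₁
  have cg₂ := hg.cont₂
  set w₀ : Vec p → ℝ := fun h => θ * (‖h‖ ^ 2 + f₁ - s) with hw₀
  have cw : Continuous w₀ := by fun_prop
  have am : Measurable fun w : Vec p × Vec p => inner ℝ w.1 w.2 := by fun_prop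
  have vm : Measurable fun x : Vec p => ‖x‖ ^ 2 - f₁ := by fun_prop
  have vm' : Measurable fun w : Vec p × Vec p => ‖w.2‖ ^ 2 - f₁ := by fun_prop
  have iaq := integrable_abs_inner_rpow_prod hq hH (hν.integrable_norm_rpow hq)
  have ivq : Integrable (fun w : Vec p × Vec p => |‖w.2‖ ^ 2 - f₁| ^ (2 + δ)) (H.prod ν) :=
    hν.integrable.comp_snd H
  have ia : Integrable (fun w : Vec p × Vec p => inner ℝ w.1 w.2) (H.prod ν) :=
    integrable_of_abs_rpow (by linarith) am iaq
  have iv := integrable_of_abs_rpow (by linarith) vm' ivq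
  have ia2 := integrable_sq_of_abs_rpow (by linarith) am iaq
  have iv2 := integrable_sq_of_abs_rpow (by linarith) vm' ivq
  have iav : Integrable (fun w : Vec p × Vec p => |inner ℝ w.1 w.2 * (‖w.2‖ ^ 2 - f₁)|)
      (H.prod ν) := by
    refine (ia2.add iv2).mono' (Measurable.aestronglyMeasurable (by fun_prop))
      (ae_of_all _ fun w => ?_)
    rw [Real.norm_of_nonneg (abs_nonneg _), abs_mul]
    simp only [Pi.add_apply]
    rw [← sq_abs (inner ℝ w.1 w.2), ← sq_abs (‖w.2‖ ^ 2 - f₁)]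
    nlinarith [sq_nonneg (|inner ℝ w.1 w.2| - |‖w.2‖ ^ 2 - f₁|),
      sq_nonneg (|inner ℝ w.1 w.2|), sq_nonneg |‖w.2‖ ^ 2 - f₁|]
  set d : Vec p × Vec p → ℝ := fun w => θ * (2 * inner ℝ w.1 w.2 + (‖w.2‖ ^ 2 - f₁)) with hd
  have idq : Integrable (fun w => |d w| ^ (2 + δ)) (H.prod ν) := by
    have h1 : Integrable (fun w : Vec p × Vec p => |2 * inner ℝ w.1 w.2| ^ (2 + δ)) (H.prod ν) := by
      refine (iaq.const_mul (2 ^ (2 + δ))).congr (ae_of_all _ fun w => ?_)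
      simp only
      rw [abs_mul, Real.mul_rpow (by positivity) (by positivity), abs_two]
    refine ((integrable_abs_add_rpow hq (by fun_prop) vm' h1 ivq).const_mul (|θ| ^ (2 + δ))).congr
      (ae_of_all _ fun w => ?_)
    simp only [hd]
    rw [abs_mul, Real.mul_rpow (by positivity) (by positivity)]
  have id : Integrable d (H.prod ν) := ((ia.const_mul 2).add iv).const_mul θ
  have ig : Integrable (fun w : Vec p × Vec p => g (θ * (‖w.1 + w.2‖ ^ 2 - s))) (H.prod ν) :=
    (integrable_const (1 : ℝ)).mono' (Continuous.aestronglyMeasurable (by fun_prop))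
      (ae_of_all _ fun w => by
        rw [Real.norm_of_nonneg (hg.nonneg _)]; exact hg.le_one _)
  have ig0 : Integrable (fun w : Vec p × Vec p => g (w₀ w.1)) (H.prod ν) :=
    (integrable_const (1 : ℝ)).mono' (Continuous.aestronglyMeasurable (by fun_prop))
      (ae_of_all _ fun w => by
        rw [Real.norm_of_nonneg (hg.nonneg _)]; exact hg.le_one _)
  have ig1 : Integrable (fun w : Vec p × Vec p => g₁ (w₀ w.1) * d w) (H.prod ν) :=
    id.bdd_mul (c := M) (Continuous.aestronglyMeasurable (by fun_prop))
      (ae_of_all _ fun w => hg.bound₁ _)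
  have ig2 : Integrable (fun w : Vec p × Vec p => g₂ (w₀ w.1) * inner ℝ w.1 w.2 ^ 2) (H.prod ν) :=
    ia2.bdd_mul (c := M) (Continuous.aestronglyMeasurable (by fun_prop))
      (ae_of_all _ fun w => hg.bound₂ _)
  have ig2' := ig2.const_mul (2 * θ ^ 2)
  have ig0' : Integrable (fun h => g (w₀ h)) H :=
    (integrable_const (1 : ℝ)).mono' (Continuous.aestronglyMeasurable (by fun_prop))
      (ae_of_all _ fun w => by
        rw [Real.norm_of_nonneg (hg.nonneg _)]; exact hg.le_one _)
  have e0 : ∫ w, g (w₀ w.1) ∂(H.prod ν) = ∫ h, g (w₀ h) ∂H := by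
    rw [integral_fun_fst (fun h => g (w₀ h))]; simp
  have ivν := integrable_of_abs_rpow (by linarith) vm hν.integrable
  have iinner : ∀ h : Vec p, Integrable (fun x => inner ℝ h x) ν := fun h =>
    integrable_of_abs_rpow (by linarith) (by fun_prop)
      (integrable_abs_inner_rpow hq (hν.integrable_norm_rpow hq) h)
  have v0 : ∫ x, (‖x‖ ^ 2 - f₁) ∂ν = 0 := by
    have : Integrable (fun x : Vec p => ‖x‖ ^ 2) ν := by
      simpa only [Pi.add_apply, sub_add_cancel] using ivν.fun_add (integrable_const f₁)
    rw [integral_sub this (integrable_const _), hν.trace]; simp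
  have e1 : ∫ w, g₁ (w₀ w.1) * d w ∂(H.prod ν) = 0 := by
    rw [integral_prod _ ig1]
    simp only [hd]
    refine integral_eq_zero_of_ae (ae_of_all _ fun h => ?_)
    change ∫ y, g₁ (w₀ h) * (θ * (2 * inner ℝ h y + (‖y‖ ^ 2 - f₁))) ∂ν = 0
    rw [integral_const_mul, integral_const_mul, integral_add ((iinner h).const_mul 2) ivν,
      integral_const_mul, hν.mean, v0]
    simp
  have e2 : ∫ w, g₂ (w₀ w.1) * inner ℝ w.1 w.2 ^ 2 ∂(H.prod ν) = ∫ h, g₂ (w₀ h) * Q h ∂H := by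
    rw [integral_prod _ ig2]
    simp_rw [integral_const_mul, hν.var]
  have ig2Q : Integrable (fun h => g₂ (w₀ h) * Q h) H := by
    have := ig2.integral_prod_left
    simpa only [integral_const_mul, hν.var] using this
  have split : ∫ z, g (θ * (‖z‖ ^ 2 - s)) ∂(H ∗ ν) -
      ∫ h, (g (w₀ h) + 2 * θ ^ 2 * (g₂ (w₀ h) * Q h)) ∂H =
      ∫ w, (g (θ * (‖w.1 + w.2‖ ^ 2 - s)) - (g (w₀ w.1) + g₁ (w₀ w.1) * d w +
        2 * θ ^ 2 * (g₂ (w₀ w.1) * inner ℝ w.1 w.2 ^ 2))) ∂(H.prod ν) := by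
    have k1 : Integrable (fun w => g (w₀ w.1) + g₁ (w₀ w.1) * d w) (H.prod ν) := ig0.add ig1
    have k2 : Integrable (fun w => g (w₀ w.1) + g₁ (w₀ w.1) * d w +
        2 * θ ^ 2 * (g₂ (w₀ w.1) * inner ℝ w.1 w.2 ^ 2)) (H.prod ν) := k1.add ig2'
    rw [integral_sub ig k2, integral_add k1 ig2', integral_add ig0 ig1, e0, e1,
      integral_const_mul, e2, integral_add ig0' (ig2Q.const_mul _), integral_const_mul,
      integral_conv_eq_integral_prod H ν (Continuous.measurable (by fun_prop))]
    ring
  have iB : Integrable (fun w => M * (|d w| ^ (2 + δ) +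
      2 * θ ^ 2 * |inner ℝ w.1 w.2 * (‖w.2‖ ^ 2 - f₁)| + 1 / 2 * θ ^ 2 * (‖w.2‖ ^ 2 - f₁) ^ 2))
      (H.prod ν) := ((idq.add (iav.const_mul _)).add (iv2.const_mul _)).const_mul M
  rw [split, ← Real.norm_eq_abs]
  refine (norm_integral_le_of_norm_le iB (ae_of_all _ fun w => ?_)).trans (le_of_eq ?_)
  · have ht := hg.taylor δ hδ0 hδ1 (w₀ w.1) (d w)
    have hwd : θ * (‖w.1 + w.2‖ ^ 2 - s) = w₀ w.1 + d w := by
      simp only [hw₀, hd, norm_add_sq_real]; ring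
    have hb := hg.bound₂ (w₀ w.1)
    rw [hwd, Real.norm_eq_abs]
    -- With `d = θ (2a + v)`, one has `d² / 2 = 2θ²a² + 2θ²av + θ²v²/2`; only the first part has a
    -- mean determined by the covariance.
    have hsplit : g (w₀ w.1 + d w) - (g (w₀ w.1) + g₁ (w₀ w.1) * d w +
        2 * θ ^ 2 * (g₂ (w₀ w.1) * inner ℝ w.1 w.2 ^ 2)) =
        (g (w₀ w.1 + d w) - (g (w₀ w.1) + g₁ (w₀ w.1) * d w +
          1 / 2 * (g₂ (w₀ w.1) * d w ^ 2))) +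
        g₂ (w₀ w.1) * (2 * θ ^ 2 * (inner ℝ w.1 w.2 * (‖w.2‖ ^ 2 - f₁)) +
          1 / 2 * θ ^ 2 * (‖w.2‖ ^ 2 - f₁) ^ 2) := by
      simp only [hd]; ring
    rw [hsplit]
    refine (abs_add_le _ _).trans ?_
    rw [abs_mul]
    have h2 : |2 * θ ^ 2 * (inner ℝ w.1 w.2 * (‖w.2‖ ^ 2 - f₁)) +
          1 / 2 * θ ^ 2 * (‖w.2‖ ^ 2 - f₁) ^ 2| ≤
        2 * θ ^ 2 * |inner ℝ w.1 w.2 * (‖w.2‖ ^ 2 - f₁)| +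
          1 / 2 * θ ^ 2 * (‖w.2‖ ^ 2 - f₁) ^ 2 := by
      refine (abs_add_le _ _).trans (le_of_eq ?_)
      rw [abs_mul, abs_of_nonneg (show 0 ≤ 2 * θ ^ 2 by positivity), abs_of_nonneg
        (show 0 ≤ 1 / 2 * θ ^ 2 * (‖w.2‖ ^ 2 - f₁) ^ 2 by positivity)]
    have h3 := mul_le_mul hb h2 (abs_nonneg _) ((abs_nonneg _).trans hb)
    linarith
  · have k1 : Integrable (fun w => |d w| ^ (2 + δ) +
      2 * θ ^ 2 * |inner ℝ w.1 w.2 * (‖w.2‖ ^ 2 - f₁)|) (H.prod ν) := idq.add (iav.const_mul _)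
    rw [integral_const_mul, integral_add k1 (iv2.const_mul _), integral_add idq (iav.const_mul _),
      integral_const_mul, integral_const_mul,
      integral_fun_snd (fun x : Vec p => (‖x‖ ^ 2 - f₁) ^ 2), probReal_univ, one_smul]

theorem abs_integral_conv_sub_le_of_moments {g g₁ g₂ : ℝ → ℝ} {M δ : ℝ} (hM : 0 ≤ M)
    (hg : IsTaylorCutoff g g₁ g₂ M)
    (hδ0 : 0 < δ) (hδ1 : δ ≤ 1) {Q : Vec p → ℝ} {f₁ : ℝ} {H ν : Measure (Vec p)}
    [IsProbabilityMeasure H] (hH : Integrable (fun x => ‖x‖ ^ (2 + δ)) H)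
    (hν : HasProfile Q f₁ (2 + δ) ν) {θ : ℝ} (hθ : 0 ≤ θ) (s : ℝ) {A B K v : ℝ} (hA : 0 < A)
    (hK : 0 < K) (h2 : ∫ w, inner ℝ w.1 w.2 ^ 2 ∂(H.prod ν) ≤ A ^ 2)
    (hq : ∫ w, |inner ℝ w.1 w.2| ^ (2 + δ) ∂(H.prod ν) ≤ B)
    (hK2 : ∫ x, (‖x‖ ^ 2 - f₁) ^ 2 ∂ν ≤ K ^ 2)
    (hKq : ∫ x, |‖x‖ ^ 2 - f₁| ^ (2 + δ) ∂ν ≤ v) :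
    |∫ z, g (θ * (‖z‖ ^ 2 - s)) ∂(H ∗ ν) -
      ∫ h, (g (θ * (‖h‖ ^ 2 + f₁ - s)) + 2 * θ ^ 2 * (g₂ (θ * (‖h‖ ^ 2 + f₁ - s)) * Q h)) ∂H| ≤
      64 * M * (θ ^ (2 + δ) * (B + v) + θ ^ 2 * (A * K + K ^ 2)) := by
  refine (abs_integral_conv_sub_le hg hδ0 hδ1 hH hν θ s).trans ?_
  have := hν.prob
  have hq0 : 0 ≤ 2 + δ := by linarith
  have am : Measurable fun w : Vec p × Vec p => inner ℝ w.1 w.2 := by fun_prop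
  have vm' : Measurable fun w : Vec p × Vec p => ‖w.2‖ ^ 2 - f₁ := by fun_prop
  have iaq := integrable_abs_inner_rpow_prod hq0 hH (hν.integrable_norm_rpow hq0)
  have ivq : Integrable (fun w : Vec p × Vec p => |‖w.2‖ ^ 2 - f₁| ^ (2 + δ)) (H.prod ν) :=
    hν.integrable.comp_snd H
  have ia2 := integrable_sq_of_abs_rpow (by linarith) am iaq
  have iv2 := integrable_sq_of_abs_rpow (by linarith) vm' ivq
  have ev2 : ∫ w, (‖w.2‖ ^ 2 - f₁) ^ 2 ∂(H.prod ν) = ∫ x, (‖x‖ ^ 2 - f₁) ^ 2 ∂ν := by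
    rw [integral_fun_snd (fun x : Vec p => (‖x‖ ^ 2 - f₁) ^ 2)]; simp
  have evq : ∫ w, |‖w.2‖ ^ 2 - f₁| ^ (2 + δ) ∂(H.prod ν) =
      ∫ x, |‖x‖ ^ 2 - f₁| ^ (2 + δ) ∂ν := by
    rw [integral_fun_snd (fun x : Vec p => |‖x‖ ^ 2 - f₁| ^ (2 + δ))]; simp
  have hB : 0 ≤ B := (integral_nonneg fun w => by positivity).trans hq
  have hv : 0 ≤ v := (integral_nonneg fun w => by positivity).trans hKq
  have c8 : (2 : ℝ) ^ (2 + δ) ≤ 8 := by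
    calc (2 : ℝ) ^ (2 + δ) ≤ 2 ^ (3 : ℝ) :=
          Real.rpow_le_rpow_of_exponent_le (by norm_num) (by linarith)
      _ = 8 := by norm_num
  have t1 : ∫ w, |θ * (2 * inner ℝ w.1 w.2 + (‖w.2‖ ^ 2 - f₁))| ^ (2 + δ) ∂(H.prod ν) ≤
      θ ^ (2 + δ) * (64 * B + 8 * v) := by
    have hle : ∀ w : Vec p × Vec p,
        |θ * (2 * inner ℝ w.1 w.2 + (‖w.2‖ ^ 2 - f₁))| ^ (2 + δ) ≤
        θ ^ (2 + δ) * (64 * |inner ℝ w.1 w.2| ^ (2 + δ) + 8 * |‖w.2‖ ^ 2 - f₁| ^ (2 + δ)) :=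
      fun w => by
        rw [abs_mul, abs_of_nonneg hθ, Real.mul_rpow hθ (abs_nonneg _)]
        have h1 := abs_add_rpow_le_mul hq0 (2 * inner ℝ w.1 w.2) (‖w.2‖ ^ 2 - f₁)
        rw [abs_mul, abs_two, Real.mul_rpow zero_le_two (abs_nonneg _)] at h1
        refine mul_le_mul_of_nonneg_left (h1.trans ?_) (by positivity)
        have x0 : 0 ≤ |inner ℝ w.1 w.2| ^ (2 + δ) := by positivity
        have y0 : 0 ≤ |‖w.2‖ ^ 2 - f₁| ^ (2 + δ) := by positivity
        have c0 : (0 : ℝ) ≤ 2 ^ (2 + δ) := by positivity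
        have c64 : (2 : ℝ) ^ (2 + δ) * 2 ^ (2 + δ) ≤ 64 := by nlinarith
        have := mul_le_mul_of_nonneg_right c8 y0
        have := mul_le_mul_of_nonneg_right c64 x0
        linarith
    have ir : Integrable (fun w : Vec p × Vec p => θ ^ (2 + δ) *
        (64 * |inner ℝ w.1 w.2| ^ (2 + δ) + 8 * |‖w.2‖ ^ 2 - f₁| ^ (2 + δ))) (H.prod ν) :=
      ((iaq.const_mul 64).add (ivq.const_mul 8)).const_mul _
    refine (integral_mono_of_nonneg (ae_of_all _ fun w => by positivity) ir
      (ae_of_all _ hle)).trans ?_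
    rw [integral_const_mul, integral_add (iaq.const_mul 64) (ivq.const_mul 8), integral_const_mul,
      integral_const_mul, evq]
    gcongr
  -- Cauchy–Schwarz in the form of a weighted arithmetic–geometric mean inequality; the weights make
  -- each of the two terms `A K / 2`.
  have t2 : ∫ w, |inner ℝ w.1 w.2 * (‖w.2‖ ^ 2 - f₁)| ∂(H.prod ν) ≤ A * K := by
    have hle : ∀ w : Vec p × Vec p, |inner ℝ w.1 w.2 * (‖w.2‖ ^ 2 - f₁)| ≤
        K / (2 * A) * inner ℝ w.1 w.2 ^ 2 + A / (2 * K) * (‖w.2‖ ^ 2 - f₁) ^ 2 := fun w => by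
      rw [abs_mul, ← sq_abs (inner ℝ w.1 w.2), ← sq_abs (‖w.2‖ ^ 2 - f₁)]
      set x := |inner ℝ w.1 w.2|
      set y := |‖w.2‖ ^ 2 - f₁|
      have : K / (2 * A) * x ^ 2 + A / (2 * K) * y ^ 2 - x * y = (K * x - A * y) ^ 2 / (2 * A * K) := by
        field_simp; ring
      have : 0 ≤ (K * x - A * y) ^ 2 / (2 * A * K) := by positivity
      linarith
    have ir : Integrable (fun w : Vec p × Vec p =>
        K / (2 * A) * inner ℝ w.1 w.2 ^ 2 + A / (2 * K) * (‖w.2‖ ^ 2 - f₁) ^ 2) (H.prod ν) :=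
      (ia2.const_mul _).add (iv2.const_mul _)
    refine (integral_mono_of_nonneg (ae_of_all _ fun w => abs_nonneg _) ir
      (ae_of_all _ hle)).trans ?_
    rw [integral_add (ia2.const_mul _) (iv2.const_mul _), integral_const_mul, integral_const_mul,
      ev2]
    calc _ ≤ K / (2 * A) * A ^ 2 + A / (2 * K) * K ^ 2 := by gcongr
      _ = A * K := by field_simp; ring
  have hθq : 0 ≤ θ ^ (2 + δ) := by positivity
  calc _ ≤ M * (θ ^ (2 + δ) * (64 * B + 8 * v) + 2 * θ ^ 2 * (A * K) + 1 / 2 * θ ^ 2 * K ^ 2) := by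
        gcongr
    _ ≤ M * (64 * (θ ^ (2 + δ) * (B + v) + θ ^ 2 * (A * K + K ^ 2))) := by
        refine mul_le_mul_of_nonneg_left ?_ hM
        have := mul_nonneg hθq hv
        have : 0 ≤ θ ^ 2 * (A * K) := by positivity
        have : 0 ≤ θ ^ 2 * K ^ 2 := by positivity
        linarith
    _ = _ := by ring

end Lindeberg

/-! ### The replacement argument -/

section Replacement

variable {p : ℕ} {b : OrthonormalBasis (Fin p) ℝ (Vec p)} {l : Fin p → ℝ}

theorem quadForm_le (hl : ∀ j, 0 ≤ l j) (x : Vec p) :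
    quadForm b l x ≤ (∑ j, l j) * ‖x‖ ^ 2 := by
  rw [quadForm, Finset.sum_mul]
  refine Finset.sum_le_sum fun j _ => mul_le_mul_of_nonneg_left ?_ (hl j)
  have := abs_real_inner_le_norm (b j) x
  rw [b.norm_eq_one, one_mul] at this
  rw [← sq_abs]
  gcongr

theorem HasProfile.integrable_quadForm_rpow (hl : ∀ j, 0 ≤ l j) {f₁ q : ℝ} {ν : Measure (Vec p)}
    (hν : HasProfile (quadForm b l) f₁ q ν) (hq : 0 ≤ q) :
    Integrable (fun x => quadForm b l x ^ (q / 2)) ν := by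
  have hc := (continuous_quadForm b (l := l)).rpow_const (p := q / 2)
    fun _ => Or.inr (by linarith)
  refine ((hν.integrable_norm_rpow hq).const_mul ((∑ j, l j) ^ (q / 2))).mono'
    hc.aestronglyMeasurable (ae_of_all _ fun x => ?_)
  have h0 := quadForm_nonneg b hl x
  have hs : 0 ≤ ∑ j, l j := Finset.sum_nonneg fun j _ => hl j
  rw [Real.norm_of_nonneg (Real.rpow_nonneg h0 _)]
  refine (Real.rpow_le_rpow h0 (quadForm_le hl x) (by linarith)).trans (le_of_eq ?_)
  rw [Real.mul_rpow hs (by positivity), ← Real.rpow_natCast, ← Real.rpow_mul (norm_nonneg x)]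
  congr 2; push_cast; ring

/-- The direction `b j` has variance `l j`, and `Q` weights it by `l j` again, so the mean is `∑ l j
^ 2 = tr Σ²`. -/
theorem HasProfile.integral_quadForm {f f₁ q : ℝ} (hlf : ∑ j, l j ^ 2 = f ^ 2)
    {ν : Measure (Vec p)} (hν : HasProfile (quadForm b l) f₁ q ν) (hq : 2 ≤ q) :
    Integrable (quadForm b l) ν ∧ ∫ x, quadForm b l x ∂ν = f ^ 2 := by
  have := hν.prob
  have hi : ∀ j, Integrable (fun x => l j * inner ℝ (b j) x ^ 2) ν := fun j =>
    (integrable_sq_of_abs_rpow hq (by fun_prop) (integrable_abs_inner_rpow (by linarith)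
      (hν.integrable_norm_rpow (by linarith)) (b j))).const_mul _
  refine ⟨integrable_finsetSum _ fun j _ => hi j, ?_⟩
  simp only [quadForm]
  rw [integral_finsetSum _ fun j _ => hi j, ← hlf]
  refine Finset.sum_congr rfl fun j _ => ?_
  rw [integral_const_mul, hν.var, quadForm, Finset.sum_eq_single j]
  · rw [b.inner_eq_one]; ring
  · intro i _ hij; rw [b.inner_eq_zero hij]; ring
  · simp

theorem IsPartialSum.integral_prod_inner_sq_le {f f₁ δ : ℝ} (hδ0 : 0 < δ)
    (hlf : ∑ j, l j ^ 2 = f ^ 2) {ρ : Vec p → ℝ} {n N : ℕ} (hN : N ≤ n) {H ν : Measure (Vec p)}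
    (hH : IsPartialSum (quadForm b l) ρ δ n N H) (hν : HasProfile (quadForm b l) f₁ (2 + δ) ν) :
    ∫ w, inner ℝ w.1 w.2 ^ 2 ∂(H.prod ν) ≤ (√n * f) ^ 2 := by
  have := hH.prob
  have := hν.prob
  have hq : 0 ≤ 2 + δ := by linarith
  have i2 := integrable_sq_of_abs_rpow (q := 2 + δ) (by linarith)
    (U := fun w : Vec p × Vec p => inner ℝ w.1 w.2) (by fun_prop)
    (integrable_abs_inner_rpow_prod hq hH.integrable (hν.integrable_norm_rpow hq))
  rw [integral_prod_symm _ i2]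
  simp_rw [real_inner_comm, hH.var]
  rw [integral_const_mul, (hν.integral_quadForm hlf (by linarith)).2, mul_pow,
    Real.sq_sqrt (Nat.cast_nonneg n)]
  gcongr

/-- For a fixed new summand `x`, the inner product is a marginal of the partial sum, to which the
moment bound applies; then `x` is averaged over `ν`. -/
theorem IsPartialSum.integral_prod_abs_inner_rpow_le (hl : ∀ j, 0 ≤ l j) {f₁ δ : ℝ} (hδ0 : 0 < δ)
    {ρ : Vec p → ℝ} {n N : ℕ} (hN : N ≤ n) {H ν : Measure (Vec p)}
    (hH : IsPartialSum (quadForm b l) ρ δ n N H) (hν : HasProfile (quadForm b l) f₁ (2 + δ) ν)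
    (hρ0 : ∀ x, 0 ≤ ρ x) (hρ : Integrable ρ ν) :
    ∫ w, |inner ℝ w.1 w.2| ^ (2 + δ) ∂(H.prod ν) ≤
      6 * (n * ((n : ℝ) ^ (δ / 2) * ∫ x, quadForm b l x ^ ((2 + δ) / 2) ∂ν + ∫ x, ρ x ∂ν)) := by
  have := hH.prob
  have := hν.prob
  have hq : 0 ≤ 2 + δ := by linarith
  rw [integral_prod_symm _ (integrable_abs_inner_rpow_prod hq hH.integrable
    (hν.integrable_norm_rpow hq))]
  have iQ := hν.integrable_quadForm_rpow hl hq
  have iR : Integrable (fun x => 6 * (n * ((n : ℝ) ^ (δ / 2) *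
      quadForm b l x ^ ((2 + δ) / 2) + ρ x))) ν :=
    (((iQ.const_mul _).add hρ).const_mul _).const_mul 6
  have hle : ∀ x, ∫ y, |inner ℝ y x| ^ (2 + δ) ∂H ≤ 6 * (n * ((n : ℝ) ^ (δ / 2) *
      quadForm b l x ^ ((2 + δ) / 2) + ρ x)) := fun x => by
    simp_rw [real_inner_comm x]
    refine (hH.moment x).trans ?_
    have h0 := quadForm_nonneg b hl x
    have e : (n * quadForm b l x) ^ (δ / 2) * quadForm b l x =
        (n : ℝ) ^ (δ / 2) * quadForm b l x ^ ((2 + δ) / 2) := by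
      rw [Real.mul_rpow (Nat.cast_nonneg n) h0, mul_assoc]
      congr 1
      rw [show (2 + δ) / 2 = δ / 2 + 1 by ring, Real.rpow_add_of_nonneg h0 (by linarith)
        zero_le_one, Real.rpow_one]
    rw [e]
    have : 0 ≤ (n : ℝ) ^ (δ / 2) * quadForm b l x ^ ((2 + δ) / 2) + ρ x :=
      add_nonneg (mul_nonneg (by positivity) (Real.rpow_nonneg h0 _)) (hρ0 x)
    gcongr
  refine (integral_mono_of_nonneg (ae_of_all _ fun x => integral_nonneg fun y => by positivity) iR
    (ae_of_all _ hle)).trans (le_of_eq ?_)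
  rw [integral_const_mul, integral_const_mul, integral_add (iQ.const_mul _) hρ, integral_const_mul]

/-- This inequality and the next bring the cases of an original and of a Gaussian new summand under
one constant. -/
theorem six_mul_add_le {c x y : ℝ} (hc : 0 ≤ c) (hx : 0 ≤ x) (hy : 0 ≤ y) :
    6 * (x + y + c * x) ≤ 6 * (1 + c) ^ 2 * (2 * x + y) := by
  have h1 := mul_nonneg hc hx
  have h2 := mul_nonneg hc hy
  have h3 := mul_nonneg (sq_nonneg c) hx
  have h4 := mul_nonneg (sq_nonneg c) hy
  linarith

theorem six_mul_add_le' {c x y : ℝ} (hc : 0 ≤ c) (hx : 0 ≤ x) (hy : 0 ≤ y) :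
    6 * (c * x + (c + c ^ 2) * x) ≤ 6 * (1 + c) ^ 2 * (2 * x + y) := by
  have h1 := mul_nonneg hc hx
  have h2 := mul_nonneg hc hy
  have h3 := mul_nonneg (sq_nonneg c) hx
  have h4 := mul_nonneg (sq_nonneg c) hy
  linarith

set_option maxHeartbeats 1000000 in
/-- Lindeberg's replacement of the summands by Gaussian ones. -/
theorem abs_integral_convPow_sub_le {g g₁ g₂ : ℝ → ℝ} {M δ : ℝ} (hM : 0 ≤ M)
    (hg : IsTaylorCutoff g g₁ g₂ M) (hδ0 : 0 < δ) (hδ1 : δ ≤ 1) (hl : ∀ j, 0 ≤ l j) {f : ℝ}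
    (hf : 0 < f) (hlf : ∑ j, l j ^ 2 = f ^ 2) {μ : Measure (Vec p)}
    (hμ : HasProfile (quadForm b l) (∑ j, l j) (2 + δ) μ)
    (hγ : HasProfile (quadForm b l) (∑ j, l j) (2 + δ) (gaussLaw b l))
    {K v : ℝ} (hK : 0 < K)
    (hμ2 : ∫ x, (‖x‖ ^ 2 - ∑ j, l j) ^ 2 ∂μ ≤ K ^ 2)
    (hγ2 : ∫ x, (‖x‖ ^ 2 - ∑ j, l j) ^ 2 ∂gaussLaw b l ≤ K ^ 2)
    (hμq : ∫ x, |‖x‖ ^ 2 - ∑ j, l j| ^ (2 + δ) ∂μ ≤ v)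
    (hγq : ∫ x, |‖x‖ ^ 2 - ∑ j, l j| ^ (2 + δ) ∂gaussLaw b l ≤ v)
    {n : ℕ} (hn : 1 ≤ n) {θ : ℝ} (hθ : 0 ≤ θ) (s : ℝ) :
    |∫ z, g (θ * (‖z‖ ^ 2 - s)) ∂convPow μ n -
      ∫ z, g (θ * (‖z‖ ^ 2 - s)) ∂convPow (gaussLaw b l) n| ≤
      n * (128 * M * (θ ^ (2 + δ) *
        (6 * (1 + ∫ x, |x| ^ (2 + δ) ∂gaussianReal 0 1) ^ 2 * (2 *
          (n * (n : ℝ) ^ (δ / 2) * ∫ x, quadForm b l x ^ ((2 + δ) / 2) ∂μ) +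
          n * ∫ x, ∫ y, |inner ℝ x y| ^ (2 + δ) ∂μ ∂μ) + v)
        + θ ^ 2 * (√n * f * K + K ^ 2))) := by
  have := hμ.prob
  have := hγ.prob
  have hq : 0 ≤ 2 + δ := by linarith
  set γ := gaussLaw b l with hγdef
  set Q := quadForm b l with hQ
  set c := ∫ x, |x| ^ (2 + δ) ∂gaussianReal 0 1 with hc
  set G := ∫ x, Q x ^ ((2 + δ) / 2) ∂μ with hG
  set D := ∫ x, ∫ y, |inner ℝ x y| ^ (2 + δ) ∂μ ∂μ with hD
  have hc0 : 0 ≤ c := integral_nonneg fun x => by positivity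
  have hQ0 : ∀ x, 0 ≤ Q x := quadForm_nonneg b hl
  have hG0 : 0 ≤ G := integral_nonneg fun x => Real.rpow_nonneg (hQ0 x) _
  have hD0 : 0 ≤ D := integral_nonneg fun x => integral_nonneg fun y => by positivity
  have hn1 : (1 : ℝ) ≤ n := by exact_mod_cast hn
  have hnδ : (1 : ℝ) ≤ (n : ℝ) ^ (δ / 2) := Real.one_le_rpow hn1 (by linarith)
  -- The sum of the marginal moments of `μ` and of `γ`, so that it dominates both.
  set ρ : Vec p → ℝ := fun x => ∫ y, |inner ℝ x y| ^ (2 + δ) ∂μ + Q x ^ ((2 + δ) / 2) * c with hρ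
  have hm0 : ∀ x : Vec p, 0 ≤ ∫ y, |inner ℝ x y| ^ (2 + δ) ∂μ := fun x =>
    integral_nonneg fun y => by positivity
  have hQc0 : ∀ x : Vec p, 0 ≤ Q x ^ ((2 + δ) / 2) * c := fun x =>
    mul_nonneg (Real.rpow_nonneg (hQ0 x) _) hc0
  have hρ0 : ∀ x, 0 ≤ ρ x := fun x => add_nonneg (hm0 x) (hQc0 x)
  have hρμ : ∀ x, ∫ y, |inner ℝ x y| ^ (2 + δ) ∂μ ≤ ρ x := fun x =>
    le_add_of_nonneg_right (hQc0 x)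
  have hρμγ : ∀ x, ∫ y, |inner ℝ x y| ^ (2 + δ) ∂γ ≤ ρ x := fun x => by
    rw [hγdef, integral_abs_inner_rpow_gaussLaw b hl]
    exact le_add_of_nonneg_left (hm0 x)
  have iμ := hμ.integrable_norm_rpow hq
  have iγ := hγ.integrable_norm_rpow hq
  have iQμ : Integrable (fun x => Q x ^ ((2 + δ) / 2)) μ := hμ.integrable_quadForm_rpow hl hq
  have iQγ : Integrable (fun x => Q x ^ ((2 + δ) / 2)) γ := hγ.integrable_quadForm_rpow hl hq
  have imμ : Integrable (fun x => ∫ y, |inner ℝ x y| ^ (2 + δ) ∂μ) μ :=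
    (integrable_abs_inner_rpow_prod hq iμ iμ).integral_prod_left
  have imγ : Integrable (fun x => ∫ y, |inner ℝ x y| ^ (2 + δ) ∂μ) γ :=
    (integrable_abs_inner_rpow_prod hq iγ iμ).integral_prod_left
  have iρμ : Integrable ρ μ := imμ.add (iQμ.mul_const c)
  have iργ : Integrable ρ γ := imγ.add (iQγ.mul_const c)
  -- Jensen's inequality, since `Q` has mean `f²` under `μ`. It lets `G` absorb the purely Gaussian
  -- moment in `hGγ`.
  have hfG : f ^ (2 + δ) ≤ G := by
    obtain ⟨h1, h2⟩ := hμ.integral_quadForm hlf (by linarith)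
    have := rpow_integral_le_integral_rpow (r := (2 + δ) / 2) (by linarith) hQ0 h1 iQμ
    rw [h2, ← Real.rpow_natCast, ← Real.rpow_mul hf.le] at this
    convert this using 2
    push_cast; ring
  have hGγ : ∫ x, Q x ^ ((2 + δ) / 2) ∂γ ≤ c * G := by
    refine (integral_quadForm_rpow_gaussLaw b hl hf hlf (by linarith)).2.trans ?_
    rw [mul_comm]
    gcongr
  -- In the mixed moment the Gaussian variable is integrated first, which gives `c * Q y ^ (q/2)`
  -- and hence `c * G`.
  have hργ : ∫ x, ρ x ∂γ ≤ c * G + c * G * c := by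
    rw [hρ, integral_add imγ (iQγ.mul_const c), integral_mul_const,
      integral_integral_swap (integrable_abs_inner_rpow_prod hq iγ iμ)]
    have : ∀ y : Vec p, ∫ x, |inner ℝ x y| ^ (2 + δ) ∂γ = Q y ^ ((2 + δ) / 2) * c := fun y => by
      simp_rw [real_inner_comm y]
      exact integral_abs_inner_rpow_gaussLaw b hl y (2 + δ)
    simp_rw [this]
    rw [integral_mul_const]
    have := mul_le_mul_of_nonneg_right hGγ hc0
    linarith
  have hρμ' : ∫ x, ρ x ∂μ = D + G * c := by
    rw [hρ, integral_add imμ (iQμ.mul_const c), integral_mul_const]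
  set B := 6 * (1 + c) ^ 2 * (2 * (n * (n : ℝ) ^ (δ / 2) * G) + n * D) with hB
  have hBμ : 6 * (n * ((n : ℝ) ^ (δ / 2) * ∫ x, Q x ^ ((2 + δ) / 2) ∂μ + ∫ x, ρ x ∂μ)) ≤ B := by
    rw [hρμ', hB]
    have hGn : n * G ≤ n * (n : ℝ) ^ (δ / 2) * G := by
      rw [mul_assoc]; gcongr; nlinarith
    have hDn : 0 ≤ n * D := by positivity
    have hGn0 : 0 ≤ n * (n : ℝ) ^ (δ / 2) * G := by positivity
    calc _ = 6 * (n * (n : ℝ) ^ (δ / 2) * G + n * D + c * (n * G)) := by ring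
      _ ≤ 6 * (n * (n : ℝ) ^ (δ / 2) * G + n * D + c * (n * (n : ℝ) ^ (δ / 2) * G)) := by gcongr
      _ ≤ _ := six_mul_add_le hc0 hGn0 hDn
  have hBγ : 6 * (n * ((n : ℝ) ^ (δ / 2) * ∫ x, Q x ^ ((2 + δ) / 2) ∂γ + ∫ x, ρ x ∂γ)) ≤ B := by
    have hGn : n * G ≤ n * (n : ℝ) ^ (δ / 2) * G := by
      rw [mul_assoc]; gcongr; nlinarith
    have hDn : 0 ≤ n * D := by positivity
    have hGn0 : 0 ≤ n * (n : ℝ) ^ (δ / 2) * G := by positivity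
    calc _ ≤ 6 * (n * ((n : ℝ) ^ (δ / 2) * (c * G) + (c * G + c * G * c))) := by gcongr
      _ = 6 * (c * (n * (n : ℝ) ^ (δ / 2) * G) + (c + c ^ 2) * (n * G)) := by ring
      _ ≤ 6 * (c * (n * (n : ℝ) ^ (δ / 2) * G) + (c + c ^ 2) * (n * (n : ℝ) ^ (δ / 2) * G)) := by
          gcongr
      _ ≤ B := six_mul_add_le' hc0 hGn0 hDn
  have hA : 0 < √n * f := mul_pos (Real.sqrt_pos.2 (by linarith)) hf
  set E := 64 * M * (θ ^ (2 + δ) * (B + v) + θ ^ 2 * (√n * f * K + K ^ 2)) with hE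
  have step : ∀ k, k < n →
      |∫ z, g (θ * (‖z‖ ^ 2 - s)) ∂(convPow μ (k + 1) ∗ convPow γ (n - (k + 1))) -
        ∫ z, g (θ * (‖z‖ ^ 2 - s)) ∂(convPow μ k ∗ convPow γ (n - k))| ≤ 2 * E := by
    intro k hk
    have hH := isPartialSum_convPow_conv_convPow hδ0 hδ1 hQ0 hμ hγ hρμ hρμγ
      (n := n) k (n - (k + 1)) (by omega)
    have hN : k + (n - (k + 1)) ≤ n := by omega
    set H := convPow μ k ∗ convPow γ (n - (k + 1)) with hHdef
    have := hH.prob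
    -- Neighbouring hybrids share the sum `H` of `n - 1` summands; commutativity of convolution
    -- moves the exchanged one to the end.
    have eμ : convPow μ (k + 1) ∗ convPow γ (n - (k + 1)) = H ∗ μ := by
      rw [convPow, Measure.conv_assoc, Measure.conv_comm μ, ← Measure.conv_assoc]
    have eγ : convPow μ k ∗ convPow γ (n - k) = H ∗ γ := by
      rw [show n - k = (n - (k + 1)) + 1 by omega, convPow, ← Measure.conv_assoc]
    rw [eμ, eγ]
    have b1 := abs_integral_conv_sub_le_of_moments hM hg hδ0 hδ1 hH.integrable hμ hθ s hA hK
      (hH.integral_prod_inner_sq_le hδ0 hlf hN hμ)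
      ((hH.integral_prod_abs_inner_rpow_le hl hδ0 hN hμ hρ0 iρμ).trans hBμ) hμ2 hμq
    have b2 := abs_integral_conv_sub_le_of_moments hM hg hδ0 hδ1 hH.integrable hγ hθ s hA hK
      (hH.integral_prod_inner_sq_le hδ0 hlf hN hγ)
      ((hH.integral_prod_abs_inner_rpow_le hl hδ0 hN hγ hρ0 iργ).trans hBγ) hγ2 hγq
    -- Both hybrids lie within `E` of the same comparison integral, which turns the constant 64 into
    -- 128.
    rw [abs_sub_comm] at b2
    refine (abs_sub_le _ _ _).trans ((add_le_add b1 b2).trans (le_of_eq ?_))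
    rw [two_mul]
  have tele : ∀ k, k ≤ n →
      |∫ z, g (θ * (‖z‖ ^ 2 - s)) ∂(convPow μ k ∗ convPow γ (n - k)) -
        ∫ z, g (θ * (‖z‖ ^ 2 - s)) ∂(convPow γ n)| ≤ k * (2 * E) := by
    intro k
    induction k with
    | zero => intro _; simp [convPow, Measure.dirac_zero_conv]
    | succ k ih =>
      intro hk
      refine (abs_sub_le _ _ _).trans ((add_le_add (step k hk) (ih (by omega))).trans
        (le_of_eq ?_))
      push_cast; ring
  have := tele n le_rfl
  rw [Nat.sub_self, convPow, Measure.conv_dirac_zero] at this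
  refine this.trans (le_of_eq ?_)
  rw [hE]; ring

end Replacement

/-! ### Spectral form of the covariance -/

section Spectral

variable {p : ℕ}

theorem dotProduct_mulVec_eq_quadForm {A : Matrix (Fin p) (Fin p) ℝ} (hA : A.IsHermitian)
    (x : Vec p) : x.ofLp ⬝ᵥ A.mulVec x.ofLp = quadForm hA.eigenvectorBasis hA.eigenvalues x := by
  set b := hA.eigenvectorBasis
  have e1 : x.ofLp ⬝ᵥ A.mulVec x.ofLp = inner ℝ (WithLp.toLp 2 (A.mulVec x.ofLp)) x := by
    rw [EuclideanSpace.inner_eq_star_dotProduct]; simp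
  rw [e1, ← b.sum_inner_mul_inner, quadForm]
  refine Finset.sum_congr rfl fun j _ => ?_
  have e2 : inner ℝ (WithLp.toLp 2 (A.mulVec x.ofLp)) (b j) = hA.eigenvalues j * inner ℝ (b j) x := by
    rw [EuclideanSpace.inner_eq_star_dotProduct, EuclideanSpace.inner_eq_star_dotProduct]
    simp only [star_trivial]
    rw [Matrix.dotProduct_mulVec, ← Matrix.mulVec_transpose]
    have ht : A.transpose = A := by simpa using hA.eq
    rw [ht, hA.mulVec_eigenvectorBasis, smul_dotProduct, dotProduct_comm]
    rfl
  rw [e2]; ring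

theorem trace_sq_eq_sum_eigenvalues_sq {A : Matrix (Fin p) (Fin p) ℝ} (hA : A.IsHermitian) :
    (A ^ 2).trace = ∑ j, hA.eigenvalues j ^ 2 := by
  conv_lhs => rw [hA.spectral_theorem]
  rw [← map_pow, Unitary.conjStarAlgAut_apply, Matrix.trace_mul_cycle,
    Unitary.coe_star_mul_self, one_mul, Matrix.diagonal_pow, Matrix.trace_diagonal]
  simp

theorem frob_sq {A : Matrix (Fin p) (Fin p) ℝ} (hA : A.IsHermitian) :
    ∑ j, hA.eigenvalues j ^ 2 = frob A ^ 2 := by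
  rw [frob, trace_sq_eq_sum_eigenvalues_sq hA,
    Real.sq_sqrt (Finset.sum_nonneg fun j _ => sq_nonneg _)]

theorem frob_pos {A : Matrix (Fin p) (Fin p) ℝ} (hA : A.IsHermitian) (h0 : A ≠ 0) : 0 < frob A := by
  refine (Real.sqrt_nonneg _).lt_of_ne fun h => h0 ?_
  have h1 := frob_sq hA
  rw [frob, ← h] at h1
  rw [← hA.eigenvalues_eq_zero_iff]
  ext j
  have := (Finset.sum_eq_zero_iff_of_nonneg fun j _ => sq_nonneg (hA.eigenvalues j)).1
    (h1.trans (by norm_num)) j (Finset.mem_univ j)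
  simpa using this

theorem sum_eigenvalues_eq_trace {A : Matrix (Fin p) (Fin p) ℝ} (hA : A.IsHermitian) :
    ∑ j, hA.eigenvalues j = A.trace := by
  rw [hA.trace_eq_sum_eigenvalues]; simp

end Spectral

/-! ### The law of a centred i.i.d. sequence -/

section Law

variable {Ω : Type*} [MeasurableSpace Ω] {P : Measure Ω} {p : ℕ}
  {X : ℕ → Ω → Vec p}

theorem memLp_coord (hX : IsCenteredIID P X) (i : Fin p) : MemLp (fun ω => X 0 ω i) 2 P := by
  refine hX.memLp.mono (by have := hX.measurable 0; fun_prop) (ae_of_all _ fun ω => ?_)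
  exact PiLp.norm_apply_le (X 0 ω) i

theorem lqNorm_rpow {q : ℝ} (hq : 0 < q) (Y : Ω → ℝ) :
    lqNorm P q Y ^ q = ∫ ω, |Y ω| ^ q ∂P := by
  rw [lqNorm, ← Real.rpow_mul (integral_nonneg fun ω => by positivity), one_div,
    inv_mul_cancel₀ hq.ne', Real.rpow_one]

theorem lqNorm_nonneg (q : ℝ) (Y : Ω → ℝ) : 0 ≤ lqNorm P q Y :=
  Real.rpow_nonneg (integral_nonneg fun ω => by positivity) _

theorem quadMoment_eq (hX : IsCenteredIID P X) {q : ℝ} (hq : 0 ≤ q) :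
    quadMoment P X q = ∫ x, quadForm (covMat_isHermitian P (X 0)).eigenvectorBasis
      (covEig P (X 0)) x ^ (q / 2) ∂(P.map (X 0)) := by
  have hc := (continuous_quadForm (covMat_isHermitian P (X 0)).eigenvectorBasis
    (l := covEig P (X 0))).rpow_const (p := q / 2) fun _ => Or.inr (by linarith)
  rw [integral_map (hX.measurable 0).aemeasurable hc.aestronglyMeasurable, quadMoment]
  simp_rw [dotProduct_mulVec_eq_quadForm (covMat_isHermitian P (X 0))]
  rfl

theorem abs_normSqStd_rpow (hS : covMat P (X 0) ≠ 0) (q : ℝ) (ω : Ω) :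
    |‖X 0 ω‖ ^ 2 - (covMat P (X 0)).trace| ^ q =
      frob (covMat P (X 0)) ^ q * |normSqStd P X ω| ^ q := by
  have hf := frob_pos (covMat_isHermitian P (X 0)) hS
  rw [normSqStd, abs_div, abs_of_pos hf, Real.div_rpow (abs_nonneg _) hf.le]
  field_simp

theorem integral_abs_norm_sq_sub_rpow (hX : IsCenteredIID P X) (hS : covMat P (X 0) ≠ 0) {δ : ℝ}
    (hδ : 0 ≤ δ) :
    ∫ x, |‖x‖ ^ 2 - ∑ j, covEig P (X 0) j| ^ (2 + δ) ∂(P.map (X 0)) =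
      frob (covMat P (X 0)) ^ (2 + δ) * momK P X δ ^ (2 + δ) := by
  rw [integral_map (hX.measurable 0).aemeasurable
    (Measurable.aestronglyMeasurable (by fun_prop)), momK, lqNorm_rpow (by linarith),
    ← integral_const_mul]
  have ht : ∑ j, covEig P (X 0) j = (covMat P (X 0)).trace := sum_eigenvalues_eq_trace _
  simp_rw [ht, abs_normSqStd_rpow hS]

theorem integral_norm_sq_sub_sq (hX : IsCenteredIID P X) (hS : covMat P (X 0) ≠ 0) :
    ∫ x, (‖x‖ ^ 2 - ∑ j, covEig P (X 0) j) ^ 2 ∂(P.map (X 0)) =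
      (frob (covMat P (X 0)) * momK P X 0) ^ 2 := by
  have := integral_abs_norm_sq_sub_rpow hX hS (δ := 0) le_rfl
  simpa [mul_pow] using this

variable [IsProbabilityMeasure P]

theorem integral_coord_mul_coord (hX : IsCenteredIID P X) (i k : Fin p) :
    Integrable (fun ω => X 0 ω i * X 0 ω k) P ∧
    ∫ ω, X 0 ω i * X 0 ω k ∂P = covMat P (X 0) i k := by
  have hint := hX.memLp.integrable one_le_two
  have h0 : ∀ i : Fin p, ∫ ω, X 0 ω i ∂P = 0 := fun i => by
    have := (EuclideanSpace.proj (𝕜 := ℝ) i : Vec p →L[ℝ] ℝ).integral_comp_comm hint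
    rw [hX.mean, map_zero] at this
    exact this
  refine ⟨(memLp_coord hX i).integrable_mul (memLp_coord hX k), ?_⟩
  simp only [covMat, Matrix.of_apply, covariance, h0, sub_zero]

theorem integral_inner_sq (hX : IsCenteredIID P X) (h : Vec p) :
    ∫ ω, inner ℝ h (X 0 ω) ^ 2 ∂P = quadForm (covMat_isHermitian P (X 0)).eigenvectorBasis
      (covEig P (X 0)) h := by
  rw [covEig, ← dotProduct_mulVec_eq_quadForm]
  have e : ∀ ω, inner ℝ h (X 0 ω) ^ 2 = ∑ i, ∑ k, h i * h k * (X 0 ω i * X 0 ω k) := fun ω => by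
    rw [PiLp.inner_apply, sq, Finset.sum_mul_sum]
    refine Finset.sum_congr rfl fun i _ => Finset.sum_congr rfl fun k _ => ?_
    simp only [RCLike.inner_apply, conj_trivial]; ring
  simp_rw [e]
  have hi := fun i k => (integral_coord_mul_coord hX i k).1.const_mul (h i * h k)
  rw [integral_finsetSum _ fun i _ => integrable_finsetSum _ fun k _ => hi i k]
  simp only [dotProduct, Matrix.mulVec, Finset.mul_sum]
  refine Finset.sum_congr rfl fun i _ => ?_
  rw [integral_finsetSum _ fun k _ => hi i k]
  refine Finset.sum_congr rfl fun k _ => ?_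
  rw [integral_const_mul, (integral_coord_mul_coord hX i k).2]; ring

theorem integral_norm_sq (hX : IsCenteredIID P X) :
    ∫ ω, ‖X 0 ω‖ ^ 2 ∂P = (covMat P (X 0)).trace := by
  simp_rw [EuclideanSpace.real_norm_sq_eq, sq]
  rw [integral_finsetSum _ fun i _ => (integral_coord_mul_coord hX i i).1]
  simp only [(integral_coord_mul_coord hX _ _).2, Matrix.trace, Matrix.diag]

/-- The eigenvalue is the variance of `X 0` along its eigenvector. -/
theorem covEig_nonneg (hX : IsCenteredIID P X) (j : Fin p) : 0 ≤ covEig P (X 0) j := by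
  have h := integral_inner_sq hX ((covMat_isHermitian P (X 0)).eigenvectorBasis j)
  rw [quadForm, Finset.sum_eq_single j] at h
  · rw [OrthonormalBasis.inner_eq_one] at h
    rw [one_pow, mul_one] at h
    rw [← h]
    exact integral_nonneg fun ω => sq_nonneg (inner ℝ _ (X 0 ω))
  · intro i _ hij; rw [OrthonormalBasis.inner_eq_zero _ hij]; ring
  · simp

theorem hasProfile_map (hX : IsCenteredIID P X) (hS : covMat P (X 0) ≠ 0) {δ : ℝ}
    (hK : CondK P X δ) :
    HasProfile (quadForm (covMat_isHermitian P (X 0)).eigenvectorBasis (covEig P (X 0)))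
      (∑ j, covEig P (X 0) j) (2 + δ) (P.map (X 0)) := by
  have hm := hX.measurable 0
  have ht : ∑ j, covEig P (X 0) j = (covMat P (X 0)).trace := sum_eigenvalues_eq_trace _
  refine ⟨Measure.isProbabilityMeasure_map hm.aemeasurable, ?_, fun h => ?_, fun h => ?_, ?_⟩
  · rw [integrable_map_measure (Measurable.aestronglyMeasurable (by fun_prop)) hm.aemeasurable, ht]
    exact (hK.const_mul (frob (covMat P (X 0)) ^ (2 + δ))).congr
      (ae_of_all _ fun ω => (abs_normSqStd_rpow hS (2 + δ) ω).symm)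
  · rw [integral_map hm.aemeasurable (by fun_prop),
      integral_inner (hX.memLp.integrable one_le_two), hX.mean, inner_zero_right]
  · rw [integral_map hm.aemeasurable (by fun_prop), integral_inner_sq hX]
  · rw [integral_map hm.aemeasurable (by fun_prop), integral_norm_sq hX, ht]

theorem map_sum_range (hX : IsCenteredIID P X) (n : ℕ) :
    P.map (fun ω => ∑ i ∈ Finset.range n, X i ω) = convPow (P.map (X 0)) n := by
  induction n with
  | zero => simp [convPow]
  | succ n ih =>
    have hi : IndepFun (fun ω => ∑ i ∈ Finset.range n, X i ω) (X n) P := by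
      have := hX.indep.indepFun_finsetSum_of_notMem hX.measurable
        (s := Finset.range n) (i := n) (by simp)
      rwa [Finset.sum_fn] at this
    have hm : Measurable (fun ω => ∑ i ∈ Finset.range n, X i ω) :=
      Finset.measurable_sum _ fun i _ => hX.measurable i
    rw [convPow, ← ih, ← (hX.ident n).map_eq, ← hi.map_add_eq_map_conv_map hm (hX.measurable n)]
    congr 1
    ext1 ω
    simp [Finset.sum_range_succ]

theorem integral_integral_abs_inner_rpow (hX : IsCenteredIID P X) (hS : covMat P (X 0) ≠ 0) {δ : ℝ}
    (hδ : 0 ≤ δ) (hK : CondK P X δ) :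
    ∫ x, ∫ y, |inner ℝ x y| ^ (2 + δ) ∂(P.map (X 0)) ∂(P.map (X 0)) =
      frob (covMat P (X 0)) ^ (2 + δ) * momD P X δ ^ (2 + δ) := by
  have hf := frob_pos (covMat_isHermitian P (X 0)) hS
  have hμ := hasProfile_map hX hS hK
  have := hμ.prob
  have hi := hμ.integrable_norm_rpow (by linarith)
  have hind : IndepFun (X 0) (X 1) P := hX.indep.indepFun (by norm_num)
  have hlaw : P.map (fun ω => (X 0 ω, X 1 ω)) = (P.map (X 0)).prod (P.map (X 0)) := by
    rw [(indepFun_iff_map_prod_eq_prod_map_map (hX.measurable 0).aemeasurable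
      (hX.measurable 1).aemeasurable).1 hind, (hX.ident 1).map_eq]
  rw [← integral_prod _ (integrable_abs_inner_rpow_prod (by linarith) hi hi), ← hlaw,
    integral_map ((hX.measurable 0).prodMk (hX.measurable 1)).aemeasurable
    (Measurable.aestronglyMeasurable (by fun_prop)), momD, lqNorm_rpow (by linarith),
    ← integral_const_mul]
  congr 1
  ext1 ω
  rw [crossStd, abs_div, abs_of_pos hf, Real.div_rpow (abs_nonneg _) hf.le]
  field_simp

end Law

/-! ### From smooth test functions to the Kolmogorov distance -/

theorem IsTaylorCutoff.measureReal_Iic_le {g g₁ g₂ : ℝ → ℝ} {M : ℝ}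
    (hg : IsTaylorCutoff g g₁ g₂ M) (m : Measure ℝ) [IsProbabilityMeasure m] {ψ : ℝ} (hψ : 0 < ψ)
    (t : ℝ) : m.real (Set.Iic t) ≤ ∫ r, g (ψ * (r - t)) ∂m ∧
      ∫ r, g (ψ * (r - t)) ∂m ≤ m.real (Set.Iic (t + 1 / ψ)) := by
  have cg := hg.cont
  have hi : Integrable (fun r => g (ψ * (r - t))) m :=
    (integrable_const (1 : ℝ)).mono' (Continuous.aestronglyMeasurable (by fun_prop))
      (ae_of_all _ fun w => by rw [Real.norm_of_nonneg (hg.nonneg _)]; exact hg.le_one _)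
  rw [← integral_indicator_one measurableSet_Iic, ← integral_indicator_one measurableSet_Iic]
  constructor
  · refine integral_mono ((integrable_const 1).indicator measurableSet_Iic) hi fun r => ?_
    by_cases hr : r ∈ Set.Iic t
    · rw [Set.indicator_of_mem hr, hg.eq_one]
      · rfl
      · have : r ≤ t := hr
        nlinarith
    · rw [Set.indicator_of_notMem hr]; exact hg.nonneg _
  · refine integral_mono hi ((integrable_const 1).indicator measurableSet_Iic) fun r => ?_
    by_cases hr : r ∈ Set.Iic (t + 1 / ψ)
    · rw [Set.indicator_of_mem hr]; exact hg.le_one _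
    · rw [Set.indicator_of_notMem hr]
      refine (hg.eq_zero _ ?_).le
      have h1 : t + 1 / ψ < r := not_le.1 hr
      have h2 : ψ * (1 / ψ) = 1 := by field_simp
      nlinarith

/-- The cutoffs placed at `t` and at `t - 1 / ψ` bracket the indicator of `r ≤ t`. Moving the
threshold by `1 / ψ` is paid for under `β` alone, so no concentration bound for `α` is needed. -/
theorem IsTaylorCutoff.abs_measureReal_Iic_sub_le {g g₁ g₂ : ℝ → ℝ} {M : ℝ}
    (hg : IsTaylorCutoff g g₁ g₂ M) {α β : Measure ℝ} [IsProbabilityMeasure α]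
    [IsProbabilityMeasure β] {ψ E A : ℝ} (hψ : 0 < ψ)
    (hE : ∀ t, |∫ r, g (ψ * (r - t)) ∂α - ∫ r, g (ψ * (r - t)) ∂β| ≤ E)
    (hA : ∀ t, β.real (Set.Icc (t - 1 / ψ) (t + 1 / ψ)) ≤ A) (t : ℝ) :
    |α.real (Set.Iic t) - β.real (Set.Iic t)| ≤ E + A := by
  have hh : 0 < 1 / ψ := by positivity
  have u1 : β.real (Set.Iic (t + 1 / ψ)) ≤ β.real (Set.Iic t) + A := by
    refine (measureReal_mono ?_).trans ((measureReal_union_le _ _).trans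
      (add_le_add_right (hA t) _))
    intro r hr
    rcases le_total r t with h | h
    · exact Or.inl h
    · exact Or.inr ⟨by linarith, hr⟩
  have u2 : β.real (Set.Iic t) ≤ β.real (Set.Iic (t - 1 / ψ)) + A := by
    refine (measureReal_mono ?_).trans ((measureReal_union_le _ _).trans
      (add_le_add_right (hA t) _))
    intro r hr
    have hr' : r ≤ t := hr
    rcases le_total r (t - 1 / ψ) with h | h
    · exact Or.inl h
    · exact Or.inr ⟨h, by linarith⟩
  have a1 := (hg.measureReal_Iic_le α hψ t).1
  have b1 := (hg.measureReal_Iic_le β hψ t).2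
  have a2 := (hg.measureReal_Iic_le α hψ (t - 1 / ψ)).2
  have b2 := (hg.measureReal_Iic_le β hψ (t - 1 / ψ)).1
  rw [sub_add_cancel] at a2
  have e1 := abs_le.1 (hE t)
  have e2 := abs_le.1 (hE (t - 1 / ψ))
  rw [abs_le]
  constructor <;> linarith [e1.1, e1.2, e2.1, e2.2]

/-! ### Positivity of the constants -/

theorem integral_abs_sq_sub_one_rpow_pos {r : ℝ} (hr : 0 < r) :
    0 < ∫ x : ℝ, |x ^ 2 - 1| ^ r ∂gaussianReal 0 1 := by
  have h0 : 0 ≤ᵐ[gaussianReal 0 1] fun x : ℝ => |x ^ 2 - 1| ^ r :=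
    ae_of_all _ fun x => by positivity
  refine (integral_nonneg_of_ae h0).lt_of_ne fun h => ?_
  have h1 := (integral_eq_zero_iff_of_nonneg_ae h0
    (integrable_abs_sq_sub_one_rpow_gaussianReal hr.le)).1 h.symm
  have : NullSingletonClass (gaussianReal 0 1) := nullSingletonClass_gaussianReal one_ne_zero
  have h2 : ∀ᵐ x ∂gaussianReal 0 1, x ≠ 1 := by simp [ae_iff]
  have h3 : ∀ᵐ x ∂gaussianReal 0 1, x ≠ -1 := by simp [ae_iff]
  have h4 : ∀ᵐ x ∂gaussianReal 0 1, False := by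
    filter_upwards [h1, h2, h3] with x hx h2 h3
    have : |x ^ 2 - 1| = 0 := (Real.rpow_eq_zero (abs_nonneg _) hr.ne').1 hx
    rw [abs_eq_zero, sub_eq_zero, sq_eq_one_iff] at this
    exact this.elim h2 h3
  exact IsProbabilityMeasure.ne_zero (gaussianReal 0 1) (by simpa using h4)

/-- This keeps `tildeK` away from zero uniformly in the distribution, so that it can dominate the
Gaussian moments as well and the equation for `ψ` is never degenerate. -/
theorem gaussC_pos {δ : ℝ} (hδ : 0 ≤ δ) : 0 < gaussC δ :=
  mul_pos (Real.sqrt_pos.2 (by linarith))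
    (Real.rpow_pos_of_pos (integral_abs_sq_sub_one_rpow_pos (by linarith)) _)

theorem gaussD_nonneg (δ : ℝ) : 0 ≤ gaussD δ :=
  mul_nonneg (Real.sqrt_nonneg _) (sq_nonneg _)

section Coefficients

variable {Ω : Type*} [MeasurableSpace Ω] {P : Measure Ω} {p : ℕ} {X : ℕ → Ω → Vec p}

theorem gaussC_le_tildeK (δ : ℝ) : gaussC δ ≤ tildeK P X δ :=
  le_add_of_nonneg_left (lqNorm_nonneg _ _)

theorem tildeK_pos {δ : ℝ} (hδ : 0 ≤ δ) : 0 < tildeK P X δ :=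
  (gaussC_pos hδ).trans_le (gaussC_le_tildeK δ)

theorem momK_le_tildeK {δ : ℝ} (hδ : 0 ≤ δ) : momK P X δ ≤ tildeK P X δ :=
  le_add_of_nonneg_right (gaussC_pos hδ).le

theorem momD_le_tildeD (δ : ℝ) : momD P X δ ≤ tildeD P X δ :=
  le_add_of_nonneg_right (gaussD_nonneg δ)

theorem momD_nonneg (δ : ℝ) : 0 ≤ momD P X δ := lqNorm_nonneg _ _

theorem momK_nonneg (δ : ℝ) : 0 ≤ momK P X δ := lqNorm_nonneg _ _

theorem tildeD_nonneg (δ : ℝ) : 0 ≤ tildeD P X δ :=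
  add_nonneg (momD_nonneg δ) (gaussD_nonneg δ)

theorem quadMoment_nonneg [IsProbabilityMeasure P] (hX : IsCenteredIID P X) (q : ℝ) :
    0 ≤ quadMoment P X q :=
  integral_nonneg fun ω => Real.rpow_nonneg (by
    rw [dotProduct_mulVec_eq_quadForm (covMat_isHermitian P (X 0))]
    exact quadForm_nonneg _ (covEig_nonneg hX) _) _

theorem coeffQ_nonneg [IsProbabilityMeasure P] (hX : IsCenteredIID P X) {δ : ℝ} (hδ : 0 ≤ δ)
    (n : ℕ) : 0 ≤ coeffQ P X δ n := by
  have h1 := (tildeK_pos (P := P) (X := X) hδ).le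
  have h2 := tildeD_nonneg (P := P) (X := X) δ
  have h3 := quadMoment_nonneg hX (2 + δ)
  have h4 : 0 ≤ frob (covMat P (X 0)) := Real.sqrt_nonneg _
  unfold coeffQ
  positivity

end Coefficients

/-! ### The bound in terms of `L_δ(n, ψ)` -/

/-- Bookkeeping of exponents with the powers made into variables: `Ψ = ψ^q`, `F = f^q`, `a =
n^(δ/2)`, `r = √n`, `G` for `quadMoment`, `D` and `k` for the `q`-th powers of `tildeD` and `tildeK`
at `δ`, and `t` for `tildeK` at `0`. The left side is an exact combination of the five terms of
`L_δ`. -/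
theorem replacement_error_le {n ψ f F Ψ a r G D k t κ κ' M c : ℝ} (hn : 0 < n) (hf : 0 < f)
    (hF : 0 < F) (hΨ : 0 ≤ Ψ) (ha : 0 < a) (hr : 0 < r) (hrn : r ^ 2 = n) (hG : 0 ≤ G) (hD : 0 ≤ D)
    (hk : 0 ≤ k) (ht : 0 ≤ t) (hκ : 0 ≤ κ) (hκ' : 0 ≤ κ') (hM : 0 ≤ M) (hc : 0 ≤ c) :
    n * (128 * M * (Ψ / (n ^ 2 * a ^ 2 * F) * (6 * c * (2 * (n * a * G) + n * (F * D)) + F * κ' * k)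
      + (ψ / (n * f)) ^ 2 * (r * f * (f * κ * t) + (f * κ * t) ^ 2))) ≤
    128 * M * (12 * c + κ' + κ + κ ^ 2) *
      (ψ ^ 2 * (t ^ 2 / n + t / r) + Ψ * (k / (n * a ^ 2) + G / (a * F) + D / a ^ 2)) := by
  have hL : n * (128 * M * (Ψ / (n ^ 2 * a ^ 2 * F) *
      (6 * c * (2 * (n * a * G) + n * (F * D)) + F * κ' * k)
      + (ψ / (n * f)) ^ 2 * (r * f * (f * κ * t) + (f * κ * t) ^ 2))) =
      128 * M * (12 * c * (Ψ * (G / (a * F))) + 6 * c * (Ψ * (D / a ^ 2)) +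
        κ' * (Ψ * (k / (n * a ^ 2))) + κ * (ψ ^ 2 * (t / r)) + κ ^ 2 * (ψ ^ 2 * (t ^ 2 / n))) := by
    subst hrn
    field_simp
    ring
  rw [hL, mul_assoc (128 * M)]
  refine mul_le_mul_of_nonneg_left ?_ (by positivity)
  have p1 : 0 ≤ Ψ * (G / (a * F)) := by positivity
  have p2 : 0 ≤ Ψ * (D / a ^ 2) := by positivity
  have p3 : 0 ≤ Ψ * (k / (n * a ^ 2)) := by positivity
  have p4 : 0 ≤ ψ ^ 2 * (t / r) := by positivity
  have p5 : 0 ≤ ψ ^ 2 * (t ^ 2 / n) := by positivity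
  have hκ2 := sq_nonneg κ
  set x1 := Ψ * (G / (a * F))
  set x2 := Ψ * (D / a ^ 2)
  set x3 := Ψ * (k / (n * a ^ 2))
  set x4 := ψ ^ 2 * (t / r)
  set x5 := ψ ^ 2 * (t ^ 2 / n)
  have e : ψ ^ 2 * (t ^ 2 / n + t / r) + Ψ * (k / (n * a ^ 2) + G / (a * F) + D / a ^ 2) =
      x1 + x2 + x3 + x4 + x5 := by simp only [x1, x2, x3, x4, x5]; ring
  rw [e]
  calc _ ≤ (12 * c + κ' + κ + κ ^ 2) * x1 + (12 * c + κ' + κ + κ ^ 2) * x2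
        + (12 * c + κ' + κ + κ ^ 2) * x3 + (12 * c + κ' + κ + κ ^ 2) * x4
        + (12 * c + κ' + κ + κ ^ 2) * x5 := by
        gcongr <;> linarith
    _ = _ := by ring

/-- The law of `V`. -/
noncomputable def lawV {p : ℕ} (l : Fin p → ℝ) (f : ℝ) : Measure ℝ :=
  (Measure.pi fun _ : Fin p => gaussianReal 0 1).map fun z => ∑ j, l j / f * (z j ^ 2 - 1)

instance isProbabilityMeasure_lawV {p : ℕ} (l : Fin p → ℝ) (f : ℝ) :
    IsProbabilityMeasure (lawV l f) :=
  Measure.isProbabilityMeasure_map (Measurable.aemeasurable (by fun_prop))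

theorem measureReal_Vstat_le {Ω : Type*} [MeasurableSpace Ω] (P : Measure Ω) {p : ℕ}
    (X : ℕ → Ω → Vec p) (t : ℝ) :
    (Measure.pi fun _ : Fin p => chiSqOne).real {η | Vstat P X η ≤ t} =
      (lawV (covEig P (X 0)) (frob (covMat P (X 0)))).real (Set.Iic t) := by
  have hV : Measurable (Vstat P X) := by unfold Vstat; fun_prop
  have hm : ∀ _ : Fin p, AEMeasurable (fun x : ℝ => x ^ 2) (gaussianReal 0 1) := fun _ => by fun_prop
  have hp : IsProbabilityMeasure chiSqOne := Measure.isProbabilityMeasure_map (by fun_prop)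
  unfold chiSqOne at hp
  rw [lawV, map_measureReal_apply (by fun_prop) measurableSet_Iic]
  unfold chiSqOne
  rw [← Measure.pi_map_pi hm, map_measureReal_apply (by fun_prop)
    (measurableSet_le hV measurable_const)]
  rfl

theorem lawV_Icc_le {p : ℕ} {l : Fin p → ℝ} {f : ℝ} (hf : 0 < f) (hlf : ∑ j, l j ^ 2 = f ^ 2)
    (t : ℝ) {h : ℝ} (hh : 0 < h) :
    (lawV l f).real (Set.Icc (t - h) (t + h)) ≤ Real.exp (1 / 2) *
      (∫ y, |y| ^ (-(1 / 2) : ℝ) ∂gaussianReal 0 1) * h ^ (1 / 2 : ℝ) := by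
  rw [lawV, map_measureReal_apply (by fun_prop) measurableSet_Icc]
  refine measureReal_quadratic_Icc_le ?_ t hh
  simp_rw [div_pow]
  rw [← Finset.sum_div, hlf, div_self (by positivity)]

/-- Gaussian stability: `‖z‖² / n` under the `n`-fold convolution has the law of a single `‖Y‖²`, so
`V` is the statistic of a Gaussian sample. -/
theorem integral_lawV_eq {p : ℕ} (b : OrthonormalBasis (Fin p) ℝ (Vec p)) {l : Fin p → ℝ}
    (hl : ∀ j, 0 ≤ l j) {f : ℝ} (hf : 0 < f) {n : ℕ} (hn : 1 ≤ n) {g : ℝ → ℝ} (hg : Continuous g)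
    (ψ t : ℝ) :
    ∫ r, g (ψ * (r - t)) ∂lawV l f =
      ∫ z, g (ψ / (n * f) * (‖z‖ ^ 2 - n * (∑ j, l j + f * t))) ∂convPow (gaussLaw b l) n := by
  have hn' : (0 : ℝ) < n := by exact_mod_cast hn
  rw [convPow_gaussLaw b hl, integral_map (by fun_prop)
    (Continuous.aestronglyMeasurable (by fun_prop)), lawV,
    integral_map (Measurable.aemeasurable (by fun_prop))
      (Continuous.aestronglyMeasurable (by fun_prop)),
    integral_gaussLaw b (Continuous.measurable (by fun_prop))]
  congr 1
  ext1 z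
  congr 1
  have h := norm_sq_gaussVec_sub b hl z
  rw [sub_eq_iff_eq_add] at h
  rw [norm_smul, mul_pow, Real.norm_of_nonneg (Real.sqrt_nonneg _), Real.sq_sqrt hn'.le, h]
  have e : ∑ j, l j / f * (z j ^ 2 - 1) = (∑ j, l j * (z j ^ 2 - 1)) / f := by
    rw [Finset.sum_div]
    exact Finset.sum_congr rfl fun j _ => by ring
  rw [e]
  field_simp
  ring

section

variable {Ω : Type*} [MeasurableSpace Ω] {P : Measure Ω} {p : ℕ} {X : ℕ → Ω → Vec p}

theorem Rstat_eq (n : ℕ) (hn : 1 ≤ n) (ω : Ω) :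
    Rstat P X n ω = (‖∑ i ∈ Finset.range n, X i ω‖ ^ 2 / n - (covMat P (X 0)).trace) /
      frob (covMat P (X 0)) := by
  have hn' : (0 : ℝ) < n := by exact_mod_cast hn
  rw [Rstat, sampleMean, norm_smul, mul_pow, norm_inv, Real.norm_of_nonneg hn'.le]
  congr 2
  field_simp

theorem measurable_Rstat (hX : IsCenteredIID P X) (n : ℕ) : Measurable (Rstat P X n) := by
  have : Measurable fun ω => ∑ i ∈ Finset.range n, X i ω :=
    Finset.measurable_sum _ fun i _ => hX.measurable i
  unfold Rstat sampleMean
  fun_prop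

theorem integral_map_Rstat [IsProbabilityMeasure P] (hX : IsCenteredIID P X) (hS : covMat P (X 0) ≠ 0) {n : ℕ} (hn : 1 ≤ n)
    {g : ℝ → ℝ} (hg : Continuous g) (ψ t : ℝ) :
    ∫ r, g (ψ * (r - t)) ∂(P.map (Rstat P X n)) =
      ∫ z, g (ψ / (n * frob (covMat P (X 0))) * (‖z‖ ^ 2 -
        n * (∑ j, covEig P (X 0) j + frob (covMat P (X 0)) * t))) ∂convPow (P.map (X 0)) n := by
  have hn' : (0 : ℝ) < n := by exact_mod_cast hn
  have hf := frob_pos (covMat_isHermitian P (X 0)) hS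
  have hm : Measurable fun ω => ∑ i ∈ Finset.range n, X i ω :=
    Finset.measurable_sum _ fun i _ => hX.measurable i
  rw [integral_map (measurable_Rstat hX n).aemeasurable
    (Continuous.aestronglyMeasurable (by fun_prop)), ← map_sum_range hX, integral_map hm.aemeasurable
    (Continuous.aestronglyMeasurable (by fun_prop))]
  congr 1
  ext1 ω
  congr 1
  have ht : ∑ j, covEig P (X 0) j = (covMat P (X 0)).trace := sum_eigenvalues_eq_trace _
  rw [Rstat_eq n hn, ht]
  field_simp
  ring

end

theorem exists_kolmDist_le_Lfun {δ : ℝ} (hδ0 : 0 < δ) (hδ1 : δ ≤ 1) :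
    ∃ C : ℝ, 0 < C ∧
      ∀ (p : ℕ) (Ω : Type*) [MeasurableSpace Ω] (P : Measure Ω) [IsProbabilityMeasure P]
        (X : ℕ → Ω → Vec p),
        IsCenteredIID P X → covMat P (X 0) ≠ 0 → CondK P X δ →
        ∀ n : ℕ, 1 ≤ n → ∀ ψ : ℝ, 0 < ψ →
          kolmDist P X n ≤ C * (Lfun P X δ n ψ + ψ ^ (-(1 / 2) : ℝ)) := by
  obtain ⟨g, g₁, g₂, M, hM, hg⟩ := exists_isTaylorCutoff
  obtain ⟨Cγ, hCγ, hmom⟩ := moments_norm_sq_gaussLaw hδ0 hδ1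
  set c := (1 + ∫ x, |x| ^ (2 + δ) ∂gaussianReal 0 1) ^ 2 with hc
  set A := Real.exp (1 / 2) * ∫ y, |y| ^ (-(1 / 2) : ℝ) ∂gaussianReal 0 1 with hA
  have hA0 : 0 ≤ A := mul_nonneg (Real.exp_pos _).le (integral_nonneg fun y => by positivity)
  have hc0 : 0 ≤ c := sq_nonneg _
  have hg0 := gaussC_pos le_rfl
  have hgδ := gaussC_pos hδ0.le
  -- In `κ` and `κ'` the summand 1 serves the moments of `X 0`, the quotient those of the Gaussian
  -- vector. Both are fixed before `p` and `P`, so the final constant depends on `δ` only.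
  set κ := 1 + √Cγ / gaussC 0 with hκ
  set κ' := 1 + Cγ / gaussC δ ^ (2 + δ) with hκ'
  have hκ1 : 1 ≤ κ := le_add_of_nonneg_right (by positivity)
  have hκ'1 : 1 ≤ κ' := le_add_of_nonneg_right (by positivity)
  refine ⟨128 * M * (12 * c + κ' + κ + κ ^ 2) + A, by positivity, ?_⟩
  intro p Ω _ P _ X hX hS hK n hn ψ hψ
  have hn' : (0 : ℝ) < n := by exact_mod_cast hn
  set f := frob (covMat P (X 0)) with hfdef
  have hf : 0 < f := frob_pos (covMat_isHermitian P (X 0)) hS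
  have hlf : ∑ j, covEig P (X 0) j ^ 2 = f ^ 2 := frob_sq (covMat_isHermitian P (X 0))
  set b := (covMat_isHermitian P (X 0)).eigenvectorBasis with hb
  have hl := covEig_nonneg hX
  obtain ⟨hγ, hγ2, hγq⟩ := hmom b hl hf hlf
  have hμ := hasProfile_map hX hS hK
  have ht0 := tildeK_pos (P := P) (X := X) le_rfl
  have htδ := tildeK_pos (P := P) (X := X) hδ0.le
  have hKpos : 0 < f * κ * tildeK P X 0 := by positivity
  have hμ2 : ∫ x, (‖x‖ ^ 2 - ∑ j, covEig P (X 0) j) ^ 2 ∂(P.map (X 0)) ≤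
      (f * κ * tildeK P X 0) ^ 2 := by
    rw [integral_norm_sq_sub_sq hX hS]
    have h1 := momK_nonneg (P := P) (X := X) 0
    have h2 := momK_le_tildeK (P := P) (X := X) le_rfl
    refine pow_le_pow_left₀ (by positivity) ?_ 2
    rw [mul_assoc]
    gcongr
    nlinarith
  have hγ2' : ∫ x, (‖x‖ ^ 2 - ∑ j, covEig P (X 0) j) ^ 2 ∂gaussLaw b (covEig P (X 0)) ≤
      (f * κ * tildeK P X 0) ^ 2 := by
    refine hγ2.trans ?_
    have h1 : √Cγ ≤ κ * tildeK P X 0 := by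
      calc √Cγ = √Cγ / gaussC 0 * gaussC 0 := by field_simp
        _ ≤ κ * tildeK P X 0 := by
          gcongr
          · rw [hκ]; linarith
          · exact gaussC_le_tildeK 0
    rw [mul_assoc, mul_pow, mul_comm, ← Real.sq_sqrt hCγ.le]
    gcongr
  have hμq : ∫ x, |‖x‖ ^ 2 - ∑ j, covEig P (X 0) j| ^ (2 + δ) ∂(P.map (X 0)) ≤
      f ^ (2 + δ) * κ' * tildeK P X δ ^ (2 + δ) := by
    rw [integral_abs_norm_sq_sub_rpow hX hS hδ0.le, mul_assoc]
    have h1 := Real.rpow_le_rpow (momK_nonneg δ) (momK_le_tildeK (P := P) (X := X) hδ0.le)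
      (show 0 ≤ 2 + δ by linarith)
    have h2 : 0 ≤ tildeK P X δ ^ (2 + δ) := by positivity
    gcongr
    nlinarith
  have hγq' : ∫ x, |‖x‖ ^ 2 - ∑ j, covEig P (X 0) j| ^ (2 + δ) ∂gaussLaw b (covEig P (X 0)) ≤
      f ^ (2 + δ) * κ' * tildeK P X δ ^ (2 + δ) := by
    refine hγq.trans ?_
    have h1 : Cγ ≤ κ' * tildeK P X δ ^ (2 + δ) := by
      calc Cγ = Cγ / gaussC δ ^ (2 + δ) * gaussC δ ^ (2 + δ) := by field_simp
        _ ≤ κ' * tildeK P X δ ^ (2 + δ) := by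
          gcongr
          · rw [hκ']; linarith
          · exact gaussC_le_tildeK δ
    rw [mul_assoc, mul_comm]
    gcongr
  have hE : ∀ t, |∫ r, g (ψ * (r - t)) ∂(P.map (Rstat P X n)) -
      ∫ r, g (ψ * (r - t)) ∂lawV (covEig P (X 0)) f| ≤
      128 * M * (12 * c + κ' + κ + κ ^ 2) * Lfun P X δ n ψ := by
    intro t
    rw [integral_map_Rstat hX hS hn hg.cont, integral_lawV_eq b hl hf hn hg.cont]
    refine (abs_integral_convPow_sub_le hM.le hg hδ0 hδ1 hl hf hlf hμ hγ hKpos hμ2 hγ2' hμq hγq' hn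
      -- With this `θ`, `ψ (R_n - t) = θ (‖S_n‖² - n (f₁ + f t))` for the sum `S_n`.
      (θ := ψ / (n * f)) (by positivity) _).trans ?_
    rw [integral_integral_abs_inner_rpow hX hS hδ0.le hK, ← quadMoment_eq hX (by linarith), ← hc]
    have e1 : (n : ℝ) ^ δ = ((n : ℝ) ^ (δ / 2)) ^ 2 := by
      rw [← Real.rpow_natCast, ← Real.rpow_mul hn'.le]
      congr 1; push_cast; ring
    have e2 : (n : ℝ) ^ (1 + δ) = n * ((n : ℝ) ^ (δ / 2)) ^ 2 := by
      rw [Real.rpow_add hn', Real.rpow_one, e1]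
    have e3 : (ψ / (n * f)) ^ (2 + δ) =
        ψ ^ (2 + δ) / ((n : ℝ) ^ 2 * ((n : ℝ) ^ (δ / 2)) ^ 2 * f ^ (2 + δ)) := by
      rw [Real.div_rpow hψ.le (by positivity), Real.mul_rpow hn'.le hf.le, Real.rpow_add hn', ← e1]
      norm_num
    rw [Lfun, coeffQ, e1, e2, e3]
    have hDle := Real.rpow_le_rpow (momD_nonneg δ) (momD_le_tildeD (P := P) (X := X) δ)
      (show 0 ≤ 2 + δ by linarith)
    have hD0 := momD_nonneg (P := P) (X := X) δ
    have hG0 := quadMoment_nonneg hX (2 + δ)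
    refine le_trans ?_ (replacement_error_le (ψ := ψ) hn' hf (Real.rpow_pos_of_pos hf (2 + δ))
      (Real.rpow_nonneg hψ.le (2 + δ)) (Real.rpow_pos_of_pos hn' (δ / 2))
      (Real.sqrt_pos.2 hn') (Real.sq_sqrt hn'.le) hG0
      (Real.rpow_nonneg (tildeD_nonneg δ) (2 + δ)) (Real.rpow_nonneg htδ.le (2 + δ)) ht0.le
      (by positivity : 0 ≤ κ) (by positivity : 0 ≤ κ') hM.le hc0)
    gcongr
  have hAc : ∀ t, (lawV (covEig P (X 0)) f).real (Set.Icc (t - 1 / ψ) (t + 1 / ψ)) ≤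
      A * ψ ^ (-(1 / 2) : ℝ) := by
    intro t
    refine (lawV_Icc_le hf hlf t (by positivity : 0 < 1 / ψ)).trans (le_of_eq ?_)
    rw [one_div ψ, Real.inv_rpow hψ.le, Real.rpow_neg hψ.le]
  have hR := measurable_Rstat hX n
  have := Measure.isProbabilityMeasure_map (μ := P) hR.aemeasurable
  have hL0 : 0 ≤ Lfun P X δ n ψ := by
    have := coeffQ_nonneg hX hδ0.le n
    unfold Lfun; positivity
  refine ciSup_le fun t => ?_
  have key := hg.abs_measureReal_Iic_sub_le hψ hE hAc t
  rw [map_measureReal_apply hR measurableSet_Iic, ← measureReal_Vstat_le] at key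
  refine key.trans ?_
  have h1 : 0 ≤ ψ ^ (-(1 / 2) : ℝ) := by positivity
  have h2 : 0 ≤ 128 * M * (12 * c + κ' + κ + κ ^ 2) := by positivity
  have h3 := mul_nonneg hA0 hL0
  have h4 := mul_nonneg h2 h1
  linarith

/-! ### The equation for `ψ` -/

/-- After multiplication by `ψ ^ (1/2)` the left side is continuous and strictly increasing from 0
and must equal 1. The point `m = 1 + 1 / A` satisfies `m * A ≥ 1`, hence lies at or beyond the
solution. -/
theorem existsUnique_rpow_eq {A B q : ℝ} (hA : 0 < A) (hB : 0 ≤ B) (hq : 0 < q) :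
    ∃! ψ : ℝ, 0 < ψ ∧ ψ ^ 2 * A + ψ ^ q * B = ψ ^ (-(1 / 2) : ℝ) := by
  have hmul : ∀ ψ : ℝ, 0 < ψ → (ψ ^ 2 * A + ψ ^ q * B = ψ ^ (-(1 / 2) : ℝ) ↔
      ψ ^ (1 / 2 : ℝ) * (ψ ^ 2 * A + ψ ^ q * B) = 1) := fun ψ hψ => by
    rw [Real.rpow_neg hψ.le, mul_comm (ψ ^ (1 / 2 : ℝ)),
      ← eq_div_iff (by positivity), one_div (ψ ^ (1 / 2 : ℝ))]
  set h : ℝ → ℝ := fun ψ => ψ ^ (1 / 2 : ℝ) * (ψ ^ 2 * A + ψ ^ q * B) with hh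
  have hc : Continuous h :=
    (Real.continuous_rpow_const (by norm_num)).mul (((continuous_pow 2).mul_const A).add
      ((Real.continuous_rpow_const hq.le).mul_const B))
  have h0 : h 0 = 0 := by simp [hh]
  set m := 1 + 1 / A with hm
  have hm1 : 1 ≤ m := le_add_of_nonneg_right (by positivity)
  have hAm : 1 ≤ m * A := by
    rw [hm, add_mul, one_div, inv_mul_cancel₀ hA.ne']; linarith
  have h1 : 1 ≤ h m := by
    have s1 : 1 ≤ m ^ (1 / 2 : ℝ) := Real.one_le_rpow hm1 (by norm_num)
    have s2 : 0 ≤ m ^ q * B := by positivity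
    have s3 : 1 ≤ m ^ 2 * A + m ^ q * B := by nlinarith
    exact one_le_mul_of_one_le_of_one_le s1 s3
  obtain ⟨ψ, hψ, he⟩ := intermediate_value_Icc (by linarith : (0 : ℝ) ≤ m) hc.continuousOn
    (⟨by rw [h0]; exact zero_le_one, h1⟩ : (1 : ℝ) ∈ Set.Icc (h 0) (h m))
  have hψ0 : 0 < ψ := hψ.1.lt_of_ne fun h' => by rw [← h', h0] at he; norm_num at he
  have mono : ∀ x y : ℝ, 0 < x → x < y → h x < h y := fun x y hx hxy => by
    have s1 := Real.rpow_lt_rpow hx.le hxy (by norm_num : (0 : ℝ) < 1 / 2)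
    have s2 := Real.rpow_le_rpow hx.le hxy.le hq.le
    have s3 : x ^ 2 * A + x ^ q * B ≤ y ^ 2 * A + y ^ q * B := by gcongr
    have s4 : 0 < x ^ 2 * A + x ^ q * B := by positivity
    exact mul_lt_mul s1 s3 s4 (Real.rpow_nonneg (hx.trans hxy).le _)
  refine ⟨ψ, ⟨hψ0, (hmul ψ hψ0).2 he⟩, fun y hy => ?_⟩
  have hy' := (hmul y hy.1).1 hy.2
  rcases lt_trichotomy y ψ with hlt | heq | hlt
  · exact absurd (mono y ψ hy.1 hlt) (by rw [show h y = 1 from hy', he]; exact lt_irrefl _)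
  · exact heq
  · exact absurd (mono ψ y hψ0 hlt) (by rw [show h y = 1 from hy', he]; exact lt_irrefl _)

theorem existsUnique_isPsi {Ω : Type*} [MeasurableSpace Ω] {P : Measure Ω} [IsProbabilityMeasure P]
    {p : ℕ} {X : ℕ → Ω → Vec p} (hX : IsCenteredIID P X) {δ : ℝ} (hδ : 0 < δ) {n : ℕ}
    (hn : 1 ≤ n) : ∃! ψ : ℝ, IsPsi P X δ n ψ := by
  have hn' : (0 : ℝ) < n := by exact_mod_cast hn
  have ht := tildeK_pos (P := P) (X := X) le_rfl
  exact existsUnique_rpow_eq (by positivity) (coeffQ_nonneg hX hδ.le n) (by linarith)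

/-! ### The bound at the balance point and the limit theorem -/

theorem exists_kolmDist_le {δ : ℝ} (hδ0 : 0 < δ) (hδ1 : δ ≤ 1) :
    ∃ C : ℝ, 0 < C ∧
      ∀ (p : ℕ) (Ω : Type*) [MeasurableSpace Ω] (P : Measure Ω) [IsProbabilityMeasure P]
        (X : ℕ → Ω → Vec p),
        IsCenteredIID P X → covMat P (X 0) ≠ 0 → CondK P X δ →
        ∀ n : ℕ, 1 ≤ n → ∀ ψ : ℝ, IsPsi P X δ n ψ →
          kolmDist P X n ≤ C * ψ ^ (-(1 / 2) : ℝ) := by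
  obtain ⟨C, hC, h⟩ := exists_kolmDist_le_Lfun hδ0 hδ1
  refine ⟨2 * C, by positivity, fun p Ω _ P _ X hX hS hK n hn ψ hψ => ?_⟩
  have := h p Ω P X hX hS hK n hn ψ hψ.1
  rw [hψ.2] at this
  linarith

/-- If the coefficients tend to `0`, the solutions of `A ψ² + B ψ^q = ψ^(-1/2)` tend to `∞`. -/
theorem tendsto_atTop_of_rpow_eq {A B ψ : ℕ → ℝ} {q : ℝ} (hq : 0 ≤ q) (hA0 : ∀ n, 0 ≤ A n)
    (hB0 : ∀ n, 0 ≤ B n)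
    (hA : Tendsto A atTop (𝓝 0)) (hB : Tendsto B atTop (𝓝 0))
    (hψ : ∀ n, 1 ≤ n → 0 < ψ n ∧ ψ n ^ 2 * A n + ψ n ^ q * B n = ψ n ^ (-(1 / 2) : ℝ)) :
    Tendsto ψ atTop atTop := by
  refine tendsto_atTop.2 fun R => ?_
  set S := max R 1
  have hS : 0 < S := lt_max_of_lt_right one_pos
  have hlim : Tendsto (fun n => S ^ 2 * A n + S ^ q * B n) atTop (𝓝 0) := by
    simpa using (hA.const_mul (S ^ 2)).add (hB.const_mul (S ^ q))
  filter_upwards [hlim.eventually_lt_const (by positivity : (0 : ℝ) < S ^ (-(1 / 2) : ℝ)),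
    eventually_ge_atTop 1] with n h1 h2
  -- Were `ψ n < S`, monotonicity would force `S ^ (-1/2) ≤ A n S² + B n S^q`, which fails for large
  -- `n`.
  refine (le_max_left R 1).trans (le_of_not_gt fun hlt => ?_)
  obtain ⟨h3, h4⟩ := hψ n h2
  have h5 : ψ n ^ 2 * A n + ψ n ^ q * B n ≤ S ^ 2 * A n + S ^ q * B n := by
    have := hA0 n
    have := hB0 n
    have := Real.rpow_le_rpow h3.le hlt.le hq
    have : ψ n ^ 2 ≤ S ^ 2 := pow_le_pow_left₀ h3.le hlt.le 2
    gcongr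
  have h6 : S ^ (-(1 / 2) : ℝ) ≤ ψ n ^ (-(1 / 2) : ℝ) :=
    Real.rpow_le_rpow_of_nonpos h3 hlt.le (by norm_num)
  linarith

theorem tendsto_psi {δ : ℝ} (hδ : 0 < δ) {p : ℕ → ℕ} {Ω : ℕ → Type*} [∀ n, MeasurableSpace (Ω n)]
    {P : ∀ n, Measure (Ω n)} [∀ n, IsProbabilityMeasure (P n)] {X : ∀ n, ℕ → Ω n → Vec (p n)}
    (hX : ∀ n, IsCenteredIID (P n) (X n))
    (hs : Tendsto (fun n => smallQty (P n) (X n) δ n) atTop (𝓝 0)) {ψ : ℕ → ℝ}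
    (hψ : ∀ n, 1 ≤ n → IsPsi (P n) (X n) δ n (ψ n)) : Tendsto ψ atTop atTop := by
  have hk : ∀ n, 0 ≤ tildeK (P n) (X n) 0 := fun n => (tildeK_pos le_rfl).le
  have hB0 : ∀ n, 0 ≤ coeffQ (P n) (X n) δ n := fun n => coeffQ_nonneg (hX n) hδ.le n
  have hA0 : ∀ n : ℕ, 0 ≤ tildeK (P n) (X n) 0 ^ 2 / n := fun n => by positivity
  have hA : Tendsto (fun n : ℕ => tildeK (P n) (X n) 0 ^ 2 / n) atTop (𝓝 0) :=
    squeeze_zero hA0 (fun n => le_add_of_nonneg_right (hB0 n)) hs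
  have hB : Tendsto (fun n : ℕ => coeffQ (P n) (X n) δ n) atTop (𝓝 0) :=
    squeeze_zero hB0 (fun n => le_add_of_nonneg_left (hA0 n)) hs
  -- This coefficient of `L_δ` does not occur in `smallQty`, but it is the square root of one that
  -- does.
  have hA' : Tendsto (fun n : ℕ => tildeK (P n) (X n) 0 / √n) atTop (𝓝 0) := by
    have := (Real.continuous_sqrt.tendsto 0).comp hA
    rw [Real.sqrt_zero] at this
    refine this.congr fun n => ?_
    simp only [Function.comp]
    rw [Real.sqrt_div (sq_nonneg _), Real.sqrt_sq (hk n)]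
  refine tendsto_atTop_of_rpow_eq (q := 2 + δ) (by linarith)
    (fun n => add_nonneg (hA0 n) (div_nonneg (hk n) (Real.sqrt_nonneg _))) hB0
    (by simpa using hA.add hA') hB hψ

theorem mainTheorem1 (δ : ℝ) (hδ0 : 0 < δ) (hδ1 : δ ≤ 1) :
    (∃ C : ℝ, 0 < C ∧
      ∀ (p : ℕ) (Ω : Type*) [MeasurableSpace Ω] (P : Measure Ω) [IsProbabilityMeasure P]
        (X : ℕ → Ω → Vec p),
        IsCenteredIID P X → covMat P (X 0) ≠ 0 → CondK P X δ → CondD P X δ →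
        ∀ n : ℕ, 1 ≤ n →
          (∃! ψ : ℝ, IsPsi P X δ n ψ) ∧
          ∀ ψ : ℝ, IsPsi P X δ n ψ → kolmDist P X n ≤ C * ψ ^ (-(1 / 2) : ℝ)) ∧
    (∀ (p : ℕ → ℕ) (Ω : ℕ → Type*) [∀ n, MeasurableSpace (Ω n)] (P : ∀ n, Measure (Ω n))
        [∀ n, IsProbabilityMeasure (P n)] (X : ∀ n, ℕ → Ω n → Vec (p n)),
        (∀ n, IsCenteredIID (P n) (X n)) → (∀ n, covMat (P n) (X n 0) ≠ 0) →
        (∀ n, CondK (P n) (X n) δ) → (∀ n, CondD (P n) (X n) δ) →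
        Tendsto (fun n => smallQty (P n) (X n) δ n) atTop (𝓝 0) →
          (∀ ψ : ℕ → ℝ, (∀ n, 1 ≤ n → IsPsi (P n) (X n) δ n (ψ n)) → Tendsto ψ atTop atTop) ∧
          Tendsto (fun n => kolmDist (P n) (X n) n) atTop (𝓝 0)) := by
  constructor
  · obtain ⟨C, hC, h⟩ := exists_kolmDist_le hδ0 hδ1
    exact ⟨C, hC, fun p Ω _ P _ X hX hS hK _ n hn =>
      ⟨existsUnique_isPsi hX hδ0 hn, h p Ω P X hX hS hK n hn⟩⟩
  · intro p Ω _ P _ X hX hS hK _ hs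
    refine ⟨fun ψ hψ => tendsto_psi hδ0 hX hs hψ, ?_⟩
    obtain ⟨C, hC, h⟩ := exists_kolmDist_le hδ0 hδ1
    -- At `n = 0` division by zero makes `L_δ` vanish and the equation has no solution; an arbitrary
    -- value is taken there.
    have hex : ∀ n : ℕ, ∃ ψ : ℝ, 1 ≤ n → IsPsi (P n) (X n) δ n ψ := fun n => by
      by_cases hn : 1 ≤ n
      · obtain ⟨ψ, hψ, -⟩ := existsUnique_isPsi (hX n) hδ0 hn
        exact ⟨ψ, fun _ => hψ⟩
      · exact ⟨0, fun h => absurd h hn⟩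
    choose ψ hψ using hex
    have hlim := ((tendsto_rpow_neg_atTop (by norm_num : (0 : ℝ) < 1 / 2)).comp
      (tendsto_psi hδ0 hX hs hψ)).const_mul C
    rw [mul_zero] at hlim
    refine squeeze_zero' (Eventually.of_forall fun n => Real.iSup_nonneg fun t => abs_nonneg _) ?_
      hlim
    filter_upwards [eventually_ge_atTop 1] with n hn
    exact h (p n) (Ω n) (P n) (X n) (hX n) (hS n) (hK n) n hn (ψ n) (hψ n hn)
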